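/- **Conventions.** Manifolds are smooth, Hausdorff, second countable and finite dimensional. A *dually flat manifold* $(M,h,\nabla)$ is a manifold with a Riemannian metric $h$ and a linear connection $\nabla$ such that $\nabla$ and its dual connection $\nabla^*$, defined by $X\,h(Y,Z)=h(\nabla_XY,Z)+h(Y,\nabla^*_XZ)$, are both flat (zero torsion and zero curvature). If $K$ is the connector of $\nabla$ and $\pi:TM\to M$ the projection, identify $T_u(TM)\cong T_pM\oplus T_pM$ by $A\mapsto(\pi_*A,KA)$; then $TM$ is a Kähler manifold with $g((v,w),(v',w'))=h(v,v')+h(w,w')$ and $J(v,w)=(-w,v)$. A smooth map between dually flat manifolds is *affine* if around every point it is given, in suitable affine coordinate systems, by the restriction of an affine map. A *Kähler immersion* is a holomorphic and isometric immersion. Put $\mathbb{T}^n=\mathbb{R}^n/\mathbb{Z}^n$. Let $(M,h,\nabla)$ be a connected dually flat manifold of dimension $n$, and let $N$ be a connected Kähler manifold of complex dimension $n$ with an effective, holomorphic and isometric smooth action $\Phi:\mathbb{T}^n\times N\to N$. Let $N^\circ\subseteq N$ be the set of points at which the action is free. A *toric parametrization* $(L,X,F)$ consists of a global frame $X=(X_1,\dots,X_n)$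 of $\nabla$-parallel vector fields on $M$, the lattice $L\subset TM$ of all their integral combinations, and a holomorphic and isometric diffeomorphism $F:M_L\to N^\circ$, where $M_L$ is the quotient of $TM$ by the group of translations $u\mapsto u+k_1X_1+\dots+k_nX_n$ $(k_i\in\mathbb{Z})$ with quotient map $q_L:TM\to M_L$ and the induced Kähler structure, such that $F(q_L(u+t_1X_1+\dots+t_nX_n))=\Phi([t],F(q_L(u)))$ for all $t\in\mathbb{R}^n$, $u\in TM$. If a toric parametrization exists, $\Phi$ is a *torification* of $M$, and the maps $\tau=F\circ q_L:TM\to N^\circ$ arising in this way are the *compatible covering maps*. **Statement.** Let $\Phi:\mathbb{T}^n\times N\to N$ and $\Phi':\mathbb{T}^d\times N'\to N'$ be torifications of the connected dually flat manifolds $(M,h,\nabla)$ and $(M',h',\nabla')$ of dimensions $n$ and $d$. Let $f:M\to M'$ and $m:N\to N'$ be smooth maps such that $m$ is a *lift* of $f$, that is, $m\circ\tau=\tau'\circ f_*$ for some compatible covering maps $\tau:TM\to N^\circ$ and $\tau':TM'\to(N')^\circ$. 1. $m$ is a Kähler immersion if and only if $f$ is an isometric affine immersion. 2. If $f$ is an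 isometric affine immersion, then there exists a unique Lie group homomorphism $\rho:\mathbb{T}^n\to\mathbb{T}^d$ such that $m\circ\Phi_a=\Phi'_{\rho(a)}\circ m$ for all $a\in\mathbb{T}^n$, and the kernel of $\rho$ is finite. -/

import Mathlib

open scoped Manifold ContDiff Topology Bundle

noncomputable section

namespace Torif

/-! ### Vector fields, flat connections, dually flat manifolds -/

/-- The model space of an `n`-dimensional real manifold. -/
abbrev RModel (n : ℕ) : Type := EuclideanSpace ℝ (Fin n)

/-- The model space of an `n`-dimensional complex manifold. -/
abbrev CModel (n : ℕ) : Type := EuclideanSpace ℂ (Fin n)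

section Real

variable {n : ℕ} {M : Type*} [TopologicalSpace M] [ChartedSpace (RModel n) M]
  [IsManifold (𝓡 n) ∞ M]

/-- Smooth vector fields on a real manifold. -/
def IsSmoothField (X : Π p : M, TangentSpace (𝓡 n) p) : Prop :=
  ContMDiff (𝓡 n) (𝓡 n).tangent ∞ (fun p => (⟨p, X p⟩ : TangentBundle (𝓡 n) M))

/-- Riemannian metrics on a real manifold. -/
abbrev RMetric (n : ℕ) (M : Type*) [TopologicalSpace M] [ChartedSpace (RModel n) M]
    [IsManifold (𝓡 n) ∞ M] :=
  Bundle.ContMDiffRiemannianMetric (𝓡 n) ∞ (RModel n) (TangentSpace (𝓡 n) : M → Type _)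

/-- Linear connections; `cov Y p v` is `(∇_v Y)(p)`. -/
abbrev Conn (n : ℕ) (M : Type*) [TopologicalSpace M] [ChartedSpace (RModel n) M]
    [IsManifold (𝓡 n) ∞ M] :=
  CovariantDerivative (𝓡 n) (RModel n) (TangentSpace (𝓡 n) : M → Type _)

/-- The curvature `R(X,Y)Z = ∇_X ∇_Y Z - ∇_Y ∇_X Z - ∇_{[X,Y]} Z`. -/
def curvature (cov : Conn n M) (X Y Z : Π p : M, TangentSpace (𝓡 n) p) (p : M) :
    TangentSpace (𝓡 n) p :=
  cov (fun q => cov Z q (Y q)) p (X p) - cov (fun q => cov Z q (X q)) p (Y p)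
    - cov Z p (VectorField.mlieBracket (𝓡 n) X Y p)

/-- A smooth connection is flat if its torsion and its curvature vanish. -/
structure IsFlat (cov : Conn n M) : Prop where
  smooth : CovariantDerivative.ContMDiffCovariantDerivative cov ∞
  torsion_eq_zero : ∀ p, cov.torsion p = 0
  curvature_eq_zero : ∀ X Y Z : Π p : M, TangentSpace (𝓡 n) p,
    IsSmoothField X → IsSmoothField Y → IsSmoothField Z → ∀ p, curvature cov X Y Z p = 0

/-- `cov'` is dual to `cov` with respect to `h`:
`X h(Y,Z) = h(∇_X Y, Z) + h(Y, ∇*_X Z)`. -/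
def IsDual (h : RMetric n M) (cov cov' : Conn n M) : Prop :=
  ∀ X Y Z : Π p : M, TangentSpace (𝓡 n) p,
    IsSmoothField X → IsSmoothField Y → IsSmoothField Z → ∀ p,
      (mfderiv (𝓡 n) 𝓘(ℝ, ℝ) (fun q => h.inner q (Y q) (Z q)) p (X p) : ℝ)
        = h.inner p (cov Y p (X p)) (Z p) + h.inner p (Y p) (cov' Z p (X p))

end Real

/-- A dually flat structure on `M`: a metric, a flat connection, and its dual connection (which is
determined by the other two), also flat. -/
structure DuallyFlat (n : ℕ) (M : Type*) [TopologicalSpace M] [ChartedSpace (RModel n) M]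
    [IsManifold (𝓡 n) ∞ M] where
  metric : RMetric n M
  conn : Conn n M
  dualConn : Conn n M
  dual : IsDual metric conn dualConn
  flat : IsFlat conn
  dualFlat : IsFlat dualConn

section Affine

variable {n d : ℕ}
  {M : Type*} [TopologicalSpace M] [ChartedSpace (RModel n) M] [IsManifold (𝓡 n) ∞ M]
  {M' : Type*} [TopologicalSpace M'] [ChartedSpace (RModel d) M'] [IsManifold (𝓡 d) ∞ M']

/-- The vector field on the domain of a chart `e` with constant coefficients `v` in that chart. -/
def coordField (e : OpenPartialHomeomorph M (RModel n)) (v : RModel n) :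
    Π p : M, TangentSpace (𝓡 n) p :=
  fun p => (mfderiv (𝓡 n) (𝓡 n) e p).inverse v

/-- Affine coordinate systems: smooth charts whose coordinate vector fields satisfy
`∇_{∂_i} ∂_j = 0`. -/
def IsAffineChart (cov : Conn n M) (e : OpenPartialHomeomorph M (RModel n)) : Prop :=
  e ∈ IsManifold.maximalAtlas (𝓡 n) ∞ M ∧
    ∀ v w : RModel n, ∀ p ∈ e.source, cov (coordField e w) p (coordField e v p) = 0

/-- A map is affine if around every point it is the restriction of an affine map in suitable affine
coordinates. -/
def IsAffineMap (cov : Conn n M) (cov' : Conn d M') (f : M → M') : Prop :=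
  ∀ p : M, ∃ (e : OpenPartialHomeomorph M (RModel n)) (e' : OpenPartialHomeomorph M' (RModel d)),
    IsAffineChart cov e ∧ IsAffineChart cov' e' ∧ p ∈ e.source ∧ f '' e.source ⊆ e'.source ∧
      ∃ A : RModel n →ᵃ[ℝ] RModel d, ∀ y ∈ e.target, e' (f (e.symm y)) = A y

/-- Isometric affine immersions between dually flat manifolds. -/
structure IsIsometricAffineImmersion (S : DuallyFlat n M) (S' : DuallyFlat d M') (f : M → M') :
    Prop where
  smooth : ContMDiff (𝓡 n) (𝓡 d) ∞ f
  immersion : ∀ p, Function.Injective (mfderiv (𝓡 n) (𝓡 d) f p)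
  isometric : ∀ (p : M) (v w : TangentSpace (𝓡 n) p),
    S'.metric.inner (f p) (mfderiv (𝓡 n) (𝓡 d) f p v) (mfderiv (𝓡 n) (𝓡 d) f p w)
      = S.metric.inner p v w
  affine : IsAffineMap S.conn S'.conn f

end Affine

/-! ### Dombrowski's construction on the tangent bundle -/

section Dombrowski

variable {n : ℕ} {M : Type*} [TopologicalSpace M] [ChartedSpace (RModel n) M]
  [IsManifold (𝓡 n) ∞ M]

/-- The differential `π_* : T_u(TM) → T_p M` of the projection. -/
def projDeriv (u : TangentBundle (𝓡 n) M) (A : TangentSpace (𝓡 n).tangent u) :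
    TangentSpace (𝓡 n) u.proj :=
  mfderiv (𝓡 n).tangent (𝓡 n) (Bundle.TotalSpace.proj : TangentBundle (𝓡 n) M → M) u A

/-- The Christoffel term `v ↦ ∑ Γ_{ij}^k(p) v_i u_j ∂_k` at `u ∈ T_p M`, in the preferred chart
at `p`: the covariant derivative of the vector field which extends `u` with constant coefficients
in that chart. -/
def christoffel (cov : Conn n M) (u : TangentBundle (𝓡 n) M) :
    TangentSpace (𝓡 n) u.proj →L[ℝ] TangentSpace (𝓡 n) u.proj :=
  cov (FiberBundle.extend (RModel n) u.2) u.proj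

/-- The fibre component `(q̇, ṙ) ↦ ṙ` of a vector tangent to `TM` at `u`, in the coordinates `(q, r)`
of `TM` induced by the preferred chart at the base point of `u`. -/
def fibreCoord (u : TangentBundle (𝓡 n) M) (A : TangentSpace (𝓡 n).tangent u) :
    TangentSpace (𝓡 n) u.proj :=
  (show RModel n × RModel n from A).2

/-- The vector tangent to `TM` at `u` with components `(a, b)` in the coordinates `(q, r)`. -/
def ofCoord (u : TangentBundle (𝓡 n) M) (a b : TangentSpace (𝓡 n) u.proj) :
    TangentSpace (𝓡 n).tangent u :=
  (show RModel n × RModel n from (a, b))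

/-- The connector `K_u : T_u(TM) → T_p M`. -/
def connector (cov : Conn n M) (u : TangentBundle (𝓡 n) M) (A : TangentSpace (𝓡 n).tangent u) :
    TangentSpace (𝓡 n) u.proj :=
  fibreCoord u A + christoffel cov u (projDeriv u A)

/-- Under `A ↦ (π_* A, K A)`, the metric on `TM` is `g((v,w),(v',w')) = h(v,v') + h(w,w')`. -/
def tangentMetric (S : DuallyFlat n M) (u : TangentBundle (𝓡 n) M)
    (A B : TangentSpace (𝓡 n).tangent u) : ℝ :=
  S.metric.inner u.proj (projDeriv u A) (projDeriv u B)
    + S.metric.inner u.proj (connector S.conn u A) (connector S.conn u B)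

/-- Under `A ↦ (π_* A, K A)`, the complex structure on `TM` is `J(v,w) = (-w,v)`; see
`projDeriv_tangentJ` and `connector_tangentJ`. -/
def tangentJ (cov : Conn n M) (u : TangentBundle (𝓡 n) M) (A : TangentSpace (𝓡 n).tangent u) :
    TangentSpace (𝓡 n).tangent u :=
  ofCoord u (-connector cov u A) (projDeriv u A + christoffel cov u (connector cov u A))

theorem projDeriv_ofCoord (u : TangentBundle (𝓡 n) M) (a b : TangentSpace (𝓡 n) u.proj) :
    projDeriv u (ofCoord u a b) = a := by
  have hd : HasMFDerivAt (𝓡 n).tangent (𝓡 n)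
      (Bundle.TotalSpace.proj : TangentBundle (𝓡 n) M → M) u
      (ContinuousLinearMap.fst ℝ (RModel n) (RModel n)) := by
    refine ⟨(Bundle.contMDiff_proj (n := ∞) (IB := 𝓡 n)
      (TangentSpace (𝓡 n) : M → Type _)).continuous.continuousAt, ?_⟩
    have key : ∀ y ∈ (chartAt (ModelProd (RModel n) (RModel n)) u).target,
        chartAt (RModel n) u.proj ((chartAt (RModel n) u.proj).symm y.1) = y.1 := fun y hy =>
      (chartAt (RModel n) u.proj).right_inv ((TangentBundle.mem_chart_target_iff y u).1 hy)
    refine (ContinuousLinearMap.hasFDerivWithinAt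
      (ContinuousLinearMap.fst ℝ (RModel n) (RModel n))).congr_of_eventuallyEq ?_ ?_
    · filter_upwards [extChartAt_target_mem_nhdsWithin (I := (𝓡 n).tangent) u] with y hy
      simp only [writtenInExtChartAt, mfld_simps] at hy ⊢
      exact key y hy
    · simp only [writtenInExtChartAt, mfld_simps]
      exact key _ (mem_chart_target _ u)
  unfold projDeriv
  rw [hd.mfderiv]
  rfl

theorem projDeriv_tangentJ (cov : Conn n M) (u : TangentBundle (𝓡 n) M)
    (A : TangentSpace (𝓡 n).tangent u) :
    projDeriv u (tangentJ cov u A) = -connector cov u A :=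
  projDeriv_ofCoord u _ _

theorem connector_tangentJ (cov : Conn n M) (u : TangentBundle (𝓡 n) M)
    (A : TangentSpace (𝓡 n).tangent u) :
    connector cov u (tangentJ cov u A) = projDeriv u A := by
  have h : fibreCoord u (tangentJ cov u A)
      = projDeriv u A + christoffel cov u (connector cov u A) := rfl
  rw [connector, projDeriv_tangentJ, h, map_neg]
  abel

end Dombrowski

/-! ### Kähler manifolds -/

section Kahler

/-- A complex manifold is a real smooth manifold. -/
instance isManifold_real (n : ℕ) (N : Type*) [TopologicalSpace N] [ChartedSpace (CModel n) N]
    [IsManifold 𝓘(ℂ, CModel n) ω N] : IsManifold 𝓘(ℝ, CModel n) ∞ N := by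
  apply isManifold_of_contDiffOn
  intro e e' he he'
  have h := (contDiffGroupoid ω 𝓘(ℂ, CModel n)).compatible he he'
  rw [contDiffGroupoid, mem_groupoid_of_pregroupoid] at h
  exact (h.1.restrict_scalars ℝ).of_le le_top

variable {n : ℕ} {N : Type*} [TopologicalSpace N] [ChartedSpace (CModel n) N]
  [IsManifold 𝓘(ℂ, CModel n) ω N]

/-- Smooth vector fields on a complex manifold. -/
def IsSmoothCField (X : Π p : N, TangentSpace 𝓘(ℝ, CModel n) p) : Prop :=
  ContMDiff 𝓘(ℝ, CModel n) 𝓘(ℝ, CModel n).tangent ∞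
    (fun p => (⟨p, X p⟩ : TangentBundle 𝓘(ℝ, CModel n) N))

/-- The complex structure on the tangent spaces of a complex manifold: multiplication by `i` in
the preferred holomorphic chart. -/
def complexJ {n : ℕ} {N : Type*} [TopologicalSpace N] [ChartedSpace (CModel n) N] (p : N) :
    TangentSpace 𝓘(ℝ, CModel n) p →L[ℝ] TangentSpace 𝓘(ℝ, CModel n) p :=
  show CModel n →L[ℝ] CModel n from
    (Complex.I • ContinuousLinearMap.id ℂ (CModel n)).restrictScalars ℝ

/-- A Kähler structure on a complex manifold: a Hermitian metric `g` such that the 2-form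
`ω(u,v) = g(Ju,v)` is closed. -/
structure Kahler (n : ℕ) (N : Type*) [TopologicalSpace N] [ChartedSpace (CModel n) N]
    [IsManifold 𝓘(ℂ, CModel n) ω N] where
  metric : Bundle.ContMDiffRiemannianMetric 𝓘(ℝ, CModel n) ∞ (CModel n)
    (TangentSpace 𝓘(ℝ, CModel n) : N → Type _)
  hermitian : ∀ (p : N) (v w : TangentSpace 𝓘(ℝ, CModel n) p),
    metric.inner p (complexJ p v) (complexJ p w) = metric.inner p v w
  closed : ∀ X Y Z : Π p : N, TangentSpace 𝓘(ℝ, CModel n) p,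
    IsSmoothCField X → IsSmoothCField Y → IsSmoothCField Z → ∀ p : N,
      letI form (q : N) (v w : TangentSpace 𝓘(ℝ, CModel n) q) : ℝ :=
        metric.inner q (complexJ q v) w
      letI D (φ : N → ℝ) (v : TangentSpace 𝓘(ℝ, CModel n) p) : ℝ :=
        mfderiv 𝓘(ℝ, CModel n) 𝓘(ℝ, ℝ) φ p v
      letI br (V W : Π p : N, TangentSpace 𝓘(ℝ, CModel n) p) :=
        VectorField.mlieBracket 𝓘(ℝ, CModel n) V W p
      D (fun q => form q (Y q) (Z q)) (X p) - D (fun q => form q (X q) (Z q)) (Y p)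
        + D (fun q => form q (X q) (Y q)) (Z p)
        - form p (br X Y) (Z p) + form p (br X Z) (Y p) - form p (br Y Z) (X p) = 0

variable {d : ℕ} {N' : Type*} [TopologicalSpace N'] [ChartedSpace (CModel d) N']
  [IsManifold 𝓘(ℂ, CModel d) ω N']

/-- A smooth map of complex manifolds is holomorphic if its differential commutes with the complex
structures. -/
def IsHolomorphic (n d : ℕ) {N N' : Type*} [TopologicalSpace N] [ChartedSpace (CModel n) N]
    [TopologicalSpace N'] [ChartedSpace (CModel d) N'] (m : N → N') : Prop :=
  ∀ (p : N) (v : TangentSpace 𝓘(ℝ, CModel n) p),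
    mfderiv 𝓘(ℝ, CModel n) 𝓘(ℝ, CModel d) m p (complexJ p v)
      = complexJ (m p) (mfderiv 𝓘(ℝ, CModel n) 𝓘(ℝ, CModel d) m p v)

/-- A smooth map of Kähler manifolds is isometric if it pulls back the metric to the metric. -/
def IsIsometric (G : Kahler n N) (G' : Kahler d N') (m : N → N') : Prop :=
  ∀ (p : N) (v w : TangentSpace 𝓘(ℝ, CModel n) p),
    G'.metric.inner (m p) (mfderiv 𝓘(ℝ, CModel n) 𝓘(ℝ, CModel d) m p v)
        (mfderiv 𝓘(ℝ, CModel n) 𝓘(ℝ, CModel d) m p w)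
      = G.metric.inner p v w

/-- Kähler immersions: holomorphic and isometric immersions. -/
structure IsKahlerImmersion (G : Kahler n N) (G' : Kahler d N') (m : N → N') : Prop where
  smooth : ContMDiff 𝓘(ℝ, CModel n) 𝓘(ℝ, CModel d) ∞ m
  immersion : ∀ p, Function.Injective (mfderiv 𝓘(ℝ, CModel n) 𝓘(ℝ, CModel d) m p)
  holomorphic : IsHolomorphic n d m
  isometric : IsIsometric G G' m

end Kahler

/-! ### Tori and torus actions -/

/-- The torus `ℝⁿ/ℤⁿ`. -/
abbrev Torus (n : ℕ) : Type := Fin n → UnitAddCircle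

/-- The projection `t ↦ [t]` from `ℝⁿ` to the torus. -/
def Torus.mk {n : ℕ} (t : Fin n → ℝ) : Torus n := fun i => (t i : UnitAddCircle)

/-- Lie group homomorphisms of tori, i.e. smooth group homomorphisms. The smooth structure of
the torus is the one for which `ℝⁿ → 𝕋ⁿ` is a local diffeomorphism and `ℝ/ℤ ≃ S¹` a
diffeomorphism. -/
structure IsLieHom {n d : ℕ} (ρ : Torus n →+ Torus d) : Prop where
  smooth : ∀ j : Fin d, ContMDiff 𝓘(ℝ, Fin n → ℝ) (𝓡 1) ∞
    (fun t : Fin n → ℝ => (ρ (Torus.mk t) j).toCircle)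

/-- Effective, holomorphic and isometric smooth actions of the torus on a Kähler manifold.
Smoothness on `𝕋ⁿ × N` is tested on the cover `ℝⁿ × N`. -/
structure TorusAction {n : ℕ} {N : Type*} [TopologicalSpace N] [ChartedSpace (CModel n) N]
    [IsManifold 𝓘(ℂ, CModel n) ω N] (G : Kahler n N) where
  act : Torus n → N → N
  act_zero : ∀ p, act 0 p = p
  act_add : ∀ a b p, act (a + b) p = act a (act b p)
  smooth : ContMDiff (𝓘(ℝ, Fin n → ℝ).prod 𝓘(ℝ, CModel n)) 𝓘(ℝ, CModel n) ∞
    (fun x : (Fin n → ℝ) × N => act (Torus.mk x.1) x.2)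
  effective : ∀ a, (∀ p, act a p = p) → a = 0
  holomorphic : ∀ a, IsHolomorphic n n (act a)
  isometric : ∀ a, IsIsometric G G (act a)

/-- The set `N°` of points where the action is free. -/
def TorusAction.free {n : ℕ} {N : Type*} [TopologicalSpace N] [ChartedSpace (CModel n) N]
    [IsManifold 𝓘(ℂ, CModel n) ω N] {G : Kahler n N} (Φ : TorusAction G) : Set N :=
  {p | ∀ a, Φ.act a p = p → a = 0}

/-! ### Parallel lattices, torifications and lifts -/

section Torification

variable {n : ℕ} {M : Type*} [TopologicalSpace M] [ChartedSpace (RModel n) M]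
  [IsManifold (𝓡 n) ∞ M]

/-- `X` is a generator of the parallel lattice `L ⊆ TM`: a global frame of parallel vector fields
whose integral combinations form `L`. -/
structure IsGenerator (cov : Conn n M) (L : Set (TangentBundle (𝓡 n) M))
    (X : Fin n → Π p : M, TangentSpace (𝓡 n) p) : Prop where
  smooth : ∀ i, IsSmoothField (X i)
  parallel : ∀ i p, cov (X i) p = 0
  linearIndependent : ∀ p, LinearIndependent ℝ (fun i => X i p)
  span_eq_top : ∀ p, Submodule.span ℝ (Set.range (fun i => X i p)) = ⊤
  lattice : L = {u | ∃ (p : M) (k : Fin n → ℤ), u = ⟨p, ∑ i, (k i : ℝ) • X i p⟩}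

/-- The translation `u ↦ u + t₁ X₁ + ⋯ + tₙ Xₙ` of `TM`. -/
def translate (X : Fin n → Π p : M, TangentSpace (𝓡 n) p) (t : Fin n → ℝ)
    (u : TangentBundle (𝓡 n) M) : TangentBundle (𝓡 n) M :=
  ⟨u.proj, u.2 + ∑ i, t i • X i u.proj⟩

/-- The orbit relation of the group `Γ(L)` of translations by integral combinations of `X`. -/
def orbitSetoid (X : Fin n → Π p : M, TangentSpace (𝓡 n) p) :
    Setoid (TangentBundle (𝓡 n) M) where
  r u v := ∃ k : Fin n → ℤ, v = translate X (fun i => (k i : ℝ)) u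
  iseqv :=
    { refl := fun u => ⟨0, congrArg (Bundle.TotalSpace.mk u.proj) (by simp)⟩
      symm := by
        rintro u v ⟨k, rfl⟩
        refine ⟨-k, congrArg (Bundle.TotalSpace.mk u.proj) ?_⟩
        have h : ∀ v w : TangentSpace (𝓡 n) u.proj, w = w + v + -v := fun v w => by abel
        refine (h (∑ i, (k i : ℝ) • X i u.proj) u.2).trans ?_
        refine congrArg (fun z => u.2 + ∑ i, (k i : ℝ) • X i u.proj + z) ?_
        have h' : ∀ t : Fin n → ℝ, -∑ i, t i • X i u.proj = ∑ i, (-t i) • X i u.proj :=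
          fun t => by simp
        refine (h' fun i => (k i : ℝ)).trans (Finset.sum_congr rfl fun i _ => ?_)
        exact congrArg (fun c : ℝ => c • X i u.proj) (by simp)
      trans := by
        rintro u v w ⟨k, rfl⟩ ⟨l, rfl⟩
        refine ⟨k + l, congrArg (Bundle.TotalSpace.mk u.proj) ?_⟩
        have h : ∀ v w z : TangentSpace (𝓡 n) u.proj, v + w + z = v + (w + z) := add_assoc
        refine (h u.2 (∑ i, (k i : ℝ) • X i u.proj) (∑ i, (l i : ℝ) • X i u.proj)).trans ?_
        simp [add_smul, Finset.sum_add_distrib] }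

/-- The quotient `M_L = TM / Γ(L)`, for the parallel lattice `L` generated by `X`. -/
abbrev LatticeQuotient (X : Fin n → Π p : M, TangentSpace (𝓡 n) p) : Type _ :=
  Quotient (orbitSetoid X)

/-- The quotient map `q_L : TM → M_L`. -/
def quotientMap (X : Fin n → Π p : M, TangentSpace (𝓡 n) p) (u : TangentBundle (𝓡 n) M) :
    LatticeQuotient X :=
  Quotient.mk (orbitSetoid X) u

variable {N : Type*} [TopologicalSpace N] [ChartedSpace (CModel n) N]
  [IsManifold 𝓘(ℂ, CModel n) ω N] {G : Kahler n N}

/-- A toric parametrization `(L, X, F)`: a parallel lattice `L`, a generator `X` of `L`, and an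
equivariant holomorphic and isometric diffeomorphism `F : M_L → N°`. The Kähler manifold
structure of `M_L` is the one for which the covering map `q_L : TM → M_L` is a holomorphic and
isometric local diffeomorphism, so that `F` is a holomorphic and isometric diffeomorphism
if and only if it is a homeomorphism and `F ∘ q_L` is a holomorphic and isometric local
diffeomorphism. The torus acts on `M_L` by `[t] · q_L(u) = q_L(u + t₁ X₁ + ⋯ + tₙ Xₙ)`. -/
structure ToricParametrization (S : DuallyFlat n M) (Φ : TorusAction G) where
  L : Set (TangentBundle (𝓡 n) M)
  X : Fin n → Π p : M, TangentSpace (𝓡 n) p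
  isGenerator : IsGenerator S.conn L X
  F : LatticeQuotient X ≃ₜ Φ.free
  isLocalDiffeomorph : IsLocalDiffeomorph (𝓡 n).tangent 𝓘(ℝ, CModel n) ∞
    (fun u => (F (quotientMap X u) : N))
  holomorphic : ∀ (u : TangentBundle (𝓡 n) M) (A : TangentSpace (𝓡 n).tangent u),
    mfderiv (𝓡 n).tangent 𝓘(ℝ, CModel n) (fun u => (F (quotientMap X u) : N)) u
        (tangentJ S.conn u A)
      = complexJ _ (mfderiv (𝓡 n).tangent 𝓘(ℝ, CModel n) (fun u => (F (quotientMap X u) : N)) u A)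
  isometric : ∀ (u : TangentBundle (𝓡 n) M) (A B : TangentSpace (𝓡 n).tangent u),
    G.metric.inner _
        (mfderiv (𝓡 n).tangent 𝓘(ℝ, CModel n) (fun u => (F (quotientMap X u) : N)) u A)
        (mfderiv (𝓡 n).tangent 𝓘(ℝ, CModel n) (fun u => (F (quotientMap X u) : N)) u B)
      = tangentMetric S u A B
  equivariant : ∀ (t : Fin n → ℝ) (u : TangentBundle (𝓡 n) M),
    (F (quotientMap X (translate X t u)) : N) = Φ.act (Torus.mk t) (F (quotientMap X u))

/-- `Φ` is a torification of the dually flat manifold. -/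
def IsTorification (S : DuallyFlat n M) (Φ : TorusAction G) : Prop :=
  Nonempty (ToricParametrization S Φ)

/-- Compatible covering maps `τ : TM → N°`, i.e. `τ = F ∘ q_L` for a toric parametrization
`(L, X, F)`. -/
def IsCompatibleCovering (S : DuallyFlat n M) (Φ : TorusAction G)
    (τ : TangentBundle (𝓡 n) M → Φ.free) : Prop :=
  ∃ P : ToricParametrization S Φ, ∀ u, τ u = P.F (quotientMap P.X u)

variable {d : ℕ} {M' : Type*} [TopologicalSpace M'] [ChartedSpace (RModel d) M']
  [IsManifold (𝓡 d) ∞ M'] {N' : Type*} [TopologicalSpace N'] [ChartedSpace (CModel d) N']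
  [IsManifold 𝓘(ℂ, CModel d) ω N'] {G' : Kahler d N'}

/-- The smooth map `m : N → N'` is a lift of the smooth map `f : M → M'`: there are compatible
covering maps `τ`, `τ'` with `m ∘ τ = τ' ∘ f_*`. -/
structure IsLift (S : DuallyFlat n M) (Φ : TorusAction G) (S' : DuallyFlat d M')
    (Φ' : TorusAction G') (f : M → M') (m : N → N') : Prop where
  smooth_base : ContMDiff (𝓡 n) (𝓡 d) ∞ f
  smooth : ContMDiff 𝓘(ℝ, CModel n) 𝓘(ℝ, CModel d) ∞ m
  exists_covering : ∃ (τ : TangentBundle (𝓡 n) M → Φ.free) (τ' : TangentBundle (𝓡 d) M' → Φ'.free),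
    IsCompatibleCovering S Φ τ ∧ IsCompatibleCovering S' Φ' τ' ∧
      ∀ u, m (τ u) = τ' (tangentMap (𝓡 n) (𝓡 d) f u)

end Torification

end Torif

end

open scoped Manifold ContDiff Topology Bundle

set_option linter.unusedSectionVars false

/-! A parallel frame X gives a map θ = `frameCoord X` from TM to ℝⁿ, linear and bijective on each
fibre. Because the fields X_i are parallel, ∇ differentiates coefficients in the frame, and the
differential of θ at u is the coframe applied to the connector (`IsGenerator.mvfderiv_frameCoord`).
Hence, for smooth f and connected M, three conditions coincide: f is affine; the differential of f_*
intertwines the connectors; θ' ∘ f_* = a ∘ θ for one constant matrix a. Locally constant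
coefficients of the pushed-forward parallel fields lead to a matrix (`exists_hasFrameMatrix`). Going
back from the matrix to affine charts uses that parallel fields of a torsion-free connection
commute, so that a parallel frame is a coordinate frame (`IsGenerator.exists_chart`).

Under A ↦ (π_*A, KA), the map f_* is always compatible with π_*. Since J exchanges the two
components up to sign, intertwining the connectors is the same as f_* being holomorphic
(`commutesWithConnectors_iff`). In that case the differential of f_* acts as df ⊕ df, so f_* is
isometric exactly when f is. The covering maps are holomorphic isometric local diffeomorphisms,
hence all of this transfers to m at the points of N°.

To pass from N° to N one needs N° dense (`TorusAction.dense_free`). A nontrivial stabilizer is a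
closed subgroup of the torus, so it contains a nonzero torsion element. There are countably many of
these, and each has a nowhere dense fixed set by effectiveness and the identity principle; Baire's
theorem concludes. Being holomorphic or isometric is a closed condition and extends from N°.

For equivariance, f_* carries translation by t to translation by at. Integral t act trivially on N,
and the image points are free in N', so a is an integral matrix A and induces ρ. Equivariance
spreads from N° by density. Injectivity of A makes det(AᵀA) a nonzero integer that kills the kernel
of ρ, which is therefore finite. A single free image point determines ρ. -/

namespace Torif

noncomputable section

/-! ### Parallel frames, their coframes, and the connector as a differential -/

section Coframe

variable {n : ℕ} {M : Type*} [TopologicalSpace M] [ChartedSpace (RModel n) M]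
  [IsManifold (𝓡 n) ∞ M]

/-- The linear map `c ↦ ∑ cᵢ Xᵢ(p)`. -/
def frameMap (X : Fin n → Π p : M, TangentSpace (𝓡 n) p) (p : M) :
    RModel n →L[ℝ] TangentSpace (𝓡 n) p :=
  ∑ i, (EuclideanSpace.proj i : RModel n →L[ℝ] ℝ).smulRight (X i p)

theorem frameMap_apply (X : Fin n → Π p : M, TangentSpace (𝓡 n) p) (p : M) (c : RModel n) :
    frameMap X p c = ∑ i, c i • X i p := by
  rw [frameMap, sum_apply]
  rfl

/-- The coordinates of a tangent vector in the frame `X`. -/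
def coframe (X : Fin n → Π p : M, TangentSpace (𝓡 n) p) (p : M) :
    TangentSpace (𝓡 n) p →L[ℝ] RModel n :=
  (frameMap X p).inverse

variable {cov : Conn n M} {L : Set (TangentBundle (𝓡 n) M)}
  {X : Fin n → Π p : M, TangentSpace (𝓡 n) p}

theorem IsGenerator.isInvertible_frameMap (hX : IsGenerator cov L X) (p : M) :
    (frameMap X p).IsInvertible := by
  have hinj : Function.Injective (frameMap X p : RModel n →ₗ[ℝ] TangentSpace (𝓡 n) p) := by
    rw [injective_iff_map_eq_zero]
    intro c hc
    have hc' : ∑ i, c i • X i p = 0 := by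
      rw [← frameMap_apply]
      exact hc
    ext i
    exact Fintype.linearIndependent_iff.1 (hX.linearIndependent p) (fun i => c i) hc' i
  let e : RModel n ≃ₗ[ℝ] RModel n := LinearEquiv.ofInjectiveEndo
    (show RModel n →ₗ[ℝ] RModel n from (frameMap X p : RModel n →ₗ[ℝ] TangentSpace (𝓡 n) p)) hinj
  exact ⟨(show RModel n ≃L[ℝ] TangentSpace (𝓡 n) p from e.toContinuousLinearEquiv), rfl⟩

theorem IsGenerator.isInvertible_coframe (hX : IsGenerator cov L X) (p : M) :
    (coframe X p).IsInvertible :=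
  (hX.isInvertible_frameMap p).inverse

theorem IsGenerator.frameMap_coframe (hX : IsGenerator cov L X) (p : M)
    (v : TangentSpace (𝓡 n) p) : frameMap X p (coframe X p v) = v :=
  (hX.isInvertible_frameMap p).self_apply_inverse v

theorem IsGenerator.coframe_frameMap (hX : IsGenerator cov L X) (p : M) (c : RModel n) :
    coframe X p (frameMap X p c) = c :=
  (hX.isInvertible_frameMap p).inverse_apply_self c

theorem IsGenerator.coframe_injective (hX : IsGenerator cov L X) (p : M) :
    Function.Injective (coframe X p) :=
  (hX.isInvertible_coframe p).injective

/-- The frame in the trivialization of the tangent bundle at `p₀`. -/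
def trivFrame (X : Fin n → Π p : M, TangentSpace (𝓡 n) p) (p₀ q : M) : RModel n →L[ℝ] RModel n :=
  ∑ i, (EuclideanSpace.proj i : RModel n →L[ℝ] ℝ).smulRight
    (trivializationAt (RModel n) (TangentSpace (𝓡 n)) p₀ ⟨q, X i q⟩).2

/-- The coframe in the trivialization of the tangent bundle at `p₀`. -/
def trivCoframe (X : Fin n → Π p : M, TangentSpace (𝓡 n) p) (p₀ q : M) :
    RModel n →L[ℝ] RModel n :=
  (trivFrame X p₀ q).inverse

theorem trivFrame_eq (X : Fin n → Π p : M, TangentSpace (𝓡 n) p) {p₀ q : M}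
    (hq : q ∈ (chartAt (RModel n) p₀).source) :
    trivFrame X p₀ q = ((trivializationAt (RModel n) (TangentSpace (𝓡 n)) p₀).continuousLinearMapAt
      ℝ q).comp (frameMap X q) := by
  have hq' : q ∈ (trivializationAt (RModel n) (TangentSpace (𝓡 n)) p₀).baseSet := hq
  ext1 c
  rw [ContinuousLinearMap.comp_apply, frameMap_apply, map_sum, trivFrame,
    sum_apply]
  refine Finset.sum_congr rfl fun i _ => ?_
  rw [map_smul, Bundle.Trivialization.continuousLinearMapAt_apply,
    Bundle.Trivialization.linearMapAt_apply, if_pos hq']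
  rfl

theorem IsGenerator.isInvertible_trivFrame (hX : IsGenerator cov L X) {p₀ q : M}
    (hq : q ∈ (chartAt (RModel n) p₀).source) : (trivFrame X p₀ q).IsInvertible := by
  rw [trivFrame_eq X hq]
  refine ContinuousLinearMap.IsInvertible.comp ?_ (hX.isInvertible_frameMap q)
  exact ⟨(trivializationAt (RModel n) (TangentSpace (𝓡 n)) p₀).continuousLinearEquivAt ℝ q hq,
    Bundle.Trivialization.coe_continuousLinearEquivAt_eq' _ hq⟩

/-- The trivialization cancels between the frame matrix and the fibre coordinate. This writes the
coframe through a matrix between fixed vector spaces, which can be differentiated. -/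
theorem IsGenerator.coframe_eq (hX : IsGenerator cov L X) {p₀ : M} {u : TangentBundle (𝓡 n) M}
    (hq : u.proj ∈ (chartAt (RModel n) p₀).source) :
    coframe X u.proj u.2 = trivCoframe X p₀ u.proj
      (trivializationAt (RModel n) (TangentSpace (𝓡 n)) p₀ u).2 := by
  have hq' : u.proj ∈ (trivializationAt (RModel n) (TangentSpace (𝓡 n)) p₀).baseSet := hq
  symm
  rw [trivCoframe, (hX.isInvertible_trivFrame hq).inverse_apply_eq, trivFrame_eq X hq,
    ContinuousLinearMap.comp_apply, hX.frameMap_coframe,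
    Bundle.Trivialization.continuousLinearMapAt_apply,
    Bundle.Trivialization.linearMapAt_apply, if_pos hq']

theorem IsGenerator.contMDiffAt_trivFrame (hX : IsGenerator cov L X) {p₀ q : M}
    (hq : q ∈ (chartAt (RModel n) p₀).source) :
    ContMDiffAt (𝓡 n) 𝓘(ℝ, RModel n →L[ℝ] RModel n) ∞ (trivFrame X p₀) q := by
  refine ContMDiffAt.sum fun i _ => ?_
  have h := ((trivializationAt (RModel n) (TangentSpace (𝓡 n)) p₀).contMDiffAt_section_iff
    (IB := 𝓡 n) (n := ∞) (s := X i) hq).1 (hX.smooth i q)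
  exact ((ContinuousLinearMap.smulRightL ℝ (RModel n) (RModel n)
    (EuclideanSpace.proj i : RModel n →L[ℝ] ℝ)).contDiff.contDiffAt.contMDiffAt).comp q h

theorem IsGenerator.contMDiffAt_trivCoframe (hX : IsGenerator cov L X) {p₀ q : M}
    (hq : q ∈ (chartAt (RModel n) p₀).source) :
    ContMDiffAt (𝓡 n) 𝓘(ℝ, RModel n →L[ℝ] RModel n) ∞ (trivCoframe X p₀) q :=
  ((hX.isInvertible_trivFrame hq).contDiffAt_map_inverse.contMDiffAt).comp q
    (hX.contMDiffAt_trivFrame hq)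

/-- The coordinates in the frame `X`, as a function on the tangent bundle. -/
def frameCoord (X : Fin n → Π p : M, TangentSpace (𝓡 n) p) (u : TangentBundle (𝓡 n) M) :
    RModel n :=
  coframe X u.proj u.2

theorem IsGenerator.frameCoord_eventuallyEq (hX : IsGenerator cov L X)
    (u : TangentBundle (𝓡 n) M) :
    frameCoord X =ᶠ[𝓝 u] fun v => trivCoframe X u.proj v.proj
      (extChartAt (𝓡 n).tangent u v).2 := by
  have hc : ContinuousAt (Bundle.TotalSpace.proj : TangentBundle (𝓡 n) M → M) u :=
    (FiberBundle.continuous_proj (RModel n) (TangentSpace (𝓡 n))).continuousAt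
  filter_upwards [hc.preimage_mem_nhds
    ((chartAt (RModel n) u.proj).open_source.mem_nhds (mem_chart_source _ _))] with v hv
  have := hX.coframe_eq (p₀ := u.proj) (u := v) hv
  rw [frameCoord, this]
  rfl

theorem IsGenerator.contMDiff_frameCoord (hX : IsGenerator cov L X) :
    ContMDiff (𝓡 n).tangent 𝓘(ℝ, RModel n) ∞ (frameCoord X) := by
  intro u
  refine ContMDiffAt.congr_of_eventuallyEq ?_ (hX.frameCoord_eventuallyEq u)
  refine ContMDiffAt.clm_apply ?_ ?_
  · exact (hX.contMDiffAt_trivCoframe (mem_chart_source _ _)).comp u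
      (Bundle.contMDiff_proj (n := ∞) (IB := 𝓡 n) (TangentSpace (𝓡 n) : M → Type _)).contMDiffAt
  · exact (contDiff_snd.contMDiff.contMDiffAt).comp u contMDiffAt_extChartAt

/-- Differentiability of a vector field at a point. -/
abbrev IsDiffField (σ : Π p : M, TangentSpace (𝓡 n) p) (p : M) : Prop :=
  MDifferentiableAt (𝓡 n) (𝓡 n).tangent (fun q => (⟨q, σ q⟩ : TangentBundle (𝓡 n) M)) p

/-- Additivity of a connection requires differentiable summands, so the induction has to carry
differentiability of the partial sums along. -/
theorem Conn.sum {ι : Type*} (cov : Conn n M) (s : Finset ι)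
    (σ : ι → Π p : M, TangentSpace (𝓡 n) p) (p : M) (hσ : ∀ i ∈ s, IsDiffField (σ i) p) :
    IsDiffField (∑ i ∈ s, σ i) p ∧ cov (∑ i ∈ s, σ i) p = ∑ i ∈ s, cov (σ i) p := by
  classical
  induction s using Finset.induction_on with
  | empty =>
    simp only [Finset.sum_empty, CovariantDerivative.zero]
    exact ⟨Bundle.mdifferentiableAt_zeroSection .., rfl⟩
  | insert i s hi ih =>
    have h := ih fun j hj => hσ j (Finset.mem_insert_of_mem hj)
    have hi' := hσ i (Finset.mem_insert_self i s)
    rw [Finset.sum_insert hi, Finset.sum_insert hi]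
    refine ⟨mdifferentiableAt_add_section hi' h.1, ?_⟩
    rw [cov.isCovariantDerivativeOnUniv.add hi' h.1, h.2]

theorem IsGenerator.mdifferentiableAt_coframe (hX : IsGenerator cov L X)
    {σ : Π p : M, TangentSpace (𝓡 n) p} {p : M} (hσ : IsDiffField σ p) :
    MDifferentiableAt (𝓡 n) 𝓘(ℝ, RModel n) (fun q => coframe X q (σ q)) p :=
  ((hX.contMDiff_frameCoord.mdifferentiable (by simp)) ⟨p, σ p⟩).comp p hσ

/-- In a parallel frame, the covariant derivative is the derivative of the coefficients. -/
theorem IsGenerator.coframe_cov (hX : IsGenerator cov L X)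
    {σ : Π p : M, TangentSpace (𝓡 n) p} {p : M} (hσ : IsDiffField σ p)
    (a : TangentSpace (𝓡 n) p) :
    coframe X p (cov σ p a) = mvfderiv (𝓡 n) (fun q => coframe X q (σ q)) p a := by
  have hc := hX.mdifferentiableAt_coframe hσ
  have hci : ∀ i, HasMFDerivAt (𝓡 n) 𝓘(ℝ, ℝ) (fun q => coframe X q (σ q) i) p
      ((EuclideanSpace.proj i : RModel n →L[ℝ] ℝ).comp
        (mvfderiv (𝓡 n) (fun q => coframe X q (σ q)) p)) := fun i =>
    ((EuclideanSpace.proj i : RModel n →L[ℝ] ℝ).hasMFDerivAt).comp p hc.hasMFDerivAt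
  have hXi : ∀ i, IsDiffField (X i) p := fun i => (hX.smooth i p).mdifferentiableAt (by simp)
  -- Expand σ in the frame: in the Leibniz rule only the derivatives of the coefficients survive, as
  -- each X i is parallel.
  have hs : σ = ∑ i, (fun q => coframe X q (σ q) i) • X i := by
    funext q
    rw [Finset.sum_apply]
    refine (hX.frameMap_coframe q (σ q)).symm.trans (frameMap_apply X q _)
  have hcov : cov σ p a = frameMap X p (mvfderiv (𝓡 n) (fun q => coframe X q (σ q)) p a) := by
    conv_lhs => rw [hs]
    rw [(Conn.sum cov Finset.univ _ p fun i _ =>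
      (hci i).mdifferentiableAt.smul_section (hXi i)).2,
      sum_apply, frameMap_apply]
    refine Finset.sum_congr rfl fun i _ => ?_
    rw [cov.isCovariantDerivativeOnUniv.leibniz (hXi i) (hci i).mdifferentiableAt,
      hX.parallel i p, smul_zero, zero_add, ContinuousLinearMap.smulRight_apply, mvfderiv,
      (hci i).mfderiv]
    rfl
  rw [hcov, hX.coframe_frameMap]

theorem hasMFDerivAt_clm_apply {E H N V W : Type*} [NormedAddCommGroup E] [NormedSpace ℝ E]
    [TopologicalSpace H] {I : ModelWithCorners ℝ E H} [TopologicalSpace N] [ChartedSpace H N]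
    [NormedAddCommGroup V] [NormedSpace ℝ V] [NormedAddCommGroup W] [NormedSpace ℝ W]
    {T : N → V →L[ℝ] W} {r : N → V} {x : N} {T' : E →L[ℝ] V →L[ℝ] W}
    {r' : E →L[ℝ] V} (hT : HasMFDerivAt I 𝓘(ℝ, V →L[ℝ] W) T x T')
    (hr : HasMFDerivAt I 𝓘(ℝ, V) r x r') :
    HasMFDerivAt I 𝓘(ℝ, W) (fun y => T y (r y)) x ((T x).comp r' + T'.flip (r x)) := by
  refine ⟨hT.1.clm_apply hr.1, ?_⟩
  have h := HasFDerivWithinAt.clm_apply hT.2 hr.2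
  simp only [writtenInExtChartAt, mfld_simps] at h ⊢
  exact h

theorem projDeriv_eq (u : TangentBundle (𝓡 n) M) (A : TangentSpace (𝓡 n).tangent u) :
    projDeriv u A = (show RModel n × RModel n from A).1 :=
  projDeriv_ofCoord u (show RModel n × RModel n from A).1 (show RModel n × RModel n from A).2

/-- The tangent space at p is the model space as read in the preferred chart at p, so the
trivialization centred at p is the identity over p. -/
theorem trivializationAt_self_snd (p : M) (w : TangentSpace (𝓡 n) p) :
    (trivializationAt (RModel n) (TangentSpace (𝓡 n)) p ⟨p, w⟩).2 = w := by
  have h := TangentBundle.continuousLinearMapAt_trivializationAt (I := 𝓡 n)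
    (mem_chart_source (RModel n) p)
  rw [mfderiv_extChartAt_self] at h
  have h' := congrArg (fun T => T w) h
  refine Eq.trans ?_ h'
  symm
  have hq : p ∈ (trivializationAt (RModel n) (TangentSpace (𝓡 n)) p).baseSet :=
    mem_chart_source (RModel n) p
  exact congrFun (Bundle.Trivialization.coe_linearMapAt_of_mem (R := ℝ) _ hq) w

/-- The frame coordinates turn the connector into a differential. -/
theorem IsGenerator.mvfderiv_frameCoord (hX : IsGenerator cov L X) (u : TangentBundle (𝓡 n) M)
    (A : TangentSpace (𝓡 n).tangent u) :
    mvfderiv (𝓡 n).tangent (frameCoord X) u A = coframe X u.proj (connector cov u A) := by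
  set p := u.proj with hp
  set C' : RModel n →L[ℝ] RModel n →L[ℝ] RModel n := mvfderiv (𝓡 n) (trivCoframe X p) p
  set t := trivializationAt (RModel n) (TangentSpace (𝓡 n)) p
  have hC : HasMFDerivAt (𝓡 n) 𝓘(ℝ, RModel n →L[ℝ] RModel n) (trivCoframe X p) p C' :=
    ((hX.contMDiffAt_trivCoframe (mem_chart_source _ _)).mdifferentiableAt (by simp)).hasMFDerivAt
  have hπ : HasMFDerivAt (𝓡 n).tangent (𝓡 n)
      (Bundle.TotalSpace.proj : TangentBundle (𝓡 n) M → M) u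
      (ContinuousLinearMap.fst ℝ (RModel n) (RModel n)) := by
    have h := ((Bundle.contMDiff_proj (n := ∞) (IB := 𝓡 n)
      (TangentSpace (𝓡 n) : M → Type _)).mdifferentiable (by simp) u).hasMFDerivAt
    refine h.congr_mfderiv ?_
    ext1 A
    exact projDeriv_eq u A
  have hr : HasMFDerivAt (𝓡 n).tangent 𝓘(ℝ, RModel n)
      (fun v : TangentBundle (𝓡 n) M => (t v).2) u
      (ContinuousLinearMap.snd ℝ (RModel n) (RModel n)) := by
    have h := (mdifferentiableAt_extChartAt (I := (𝓡 n).tangent)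
      (mem_chart_source (ModelProd (RModel n) (RModel n)) u)).hasMFDerivAt
    rw [mfderiv_extChartAt_self] at h
    exact ((ContinuousLinearMap.snd ℝ (RModel n) (RModel n)).hasMFDerivAt).comp u h
  -- Product rule: one term is the coframe on the fibre component of A, the other differentiates the
  -- coframe matrix in the direction π_*A.
  have hθ := (hasMFDerivAt_clm_apply (hC.comp u hπ) hr).congr_of_eventuallyEq
    (hX.frameCoord_eventuallyEq u)
  -- The field that defines `christoffel` has constant fibre coordinate in this trivialization. Its
  -- coframe coefficients therefore differentiate to the second term of the product rule, which
  -- identifies that term with the Christoffel part of the connector.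
  have hE := hX.coframe_cov (σ := FiberBundle.extend (RModel n) u.2) (p := p)
    (FiberBundle.mdifferentiableAt_extend ..) (projDeriv u A)
  have hEeq : (fun q => coframe X q (FiberBundle.extend (RModel n) u.2 q)) =ᶠ[𝓝 p]
      fun q => trivCoframe X p q (t u).2 := by
    filter_upwards [(chartAt (RModel n) p).open_source.mem_nhds (mem_chart_source _ _)] with q hq
    rw [hX.coframe_eq (p₀ := p) (u := ⟨q, FiberBundle.extend (RModel n) u.2 q⟩) hq]
    congr 1
    have h := congrArg Prod.snd (t.apply_mk_symm (b := q) hq (t u).2)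
    exact h
  have hE' : HasMFDerivAt (𝓡 n) 𝓘(ℝ, RModel n)
      (fun q => coframe X q (FiberBundle.extend (RModel n) u.2 q)) p (C'.flip (t u).2) := by
    refine ((hasMFDerivAt_clm_apply hC
      (hasMFDerivAt_const (t u).2 p)).congr_of_eventuallyEq hEeq).congr_mfderiv ?_
    exact (congrArg (· + C'.flip (t u).2) (ContinuousLinearMap.comp_zero _)).trans (zero_add _)
  rw [mvfderiv, hE'.mfderiv, projDeriv_eq] at hE
  have hv : coframe X p (fibreCoord u A) = trivCoframe X p p (fibreCoord u A) := by
    rw [hX.coframe_eq (p₀ := p) (u := ⟨p, fibreCoord u A⟩) (mem_chart_source _ _)]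
    congr 1
    exact trivializationAt_self_snd p (fibreCoord u A)
  rw [mvfderiv, hθ.mfderiv, connector, map_add, christoffel, projDeriv_eq, hE, hv]
  rfl

end Coframe

/-! ### Affine charts adapted to a parallel frame -/

section AffineChart

variable {n : ℕ} {M : Type*} [TopologicalSpace M] [ChartedSpace (RModel n) M]
  [IsManifold (𝓡 n) ∞ M] {cov : Conn n M} {L : Set (TangentBundle (𝓡 n) M)}
  {X : Fin n → Π p : M, TangentSpace (𝓡 n) p}

theorem IsGenerator.isSmoothField_frameMap (hX : IsGenerator cov L X) (c : RModel n) :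
    IsSmoothField (fun q => frameMap X q c) := by
  have h : ContMDiff (𝓡 n) (𝓡 n).tangent ∞
      (fun q => (⟨q, ∑ i, (c i • X i) q⟩ : TangentBundle (𝓡 n) M)) :=
    ContMDiff.sum_section (t := fun i => c i • X i) fun i _ =>
      ContMDiff.const_smul_section (a := c i) (hX.smooth i)
  unfold IsSmoothField
  simp only [frameMap_apply]
  exact h

theorem IsGenerator.isDiffField_frameMap (hX : IsGenerator cov L X) (c : RModel n) (p : M) :
    IsDiffField (fun q => frameMap X q c) p :=
  (hX.isSmoothField_frameMap c p).mdifferentiableAt (by simp)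

theorem IsGenerator.cov_frameMap (hX : IsGenerator cov L X) (c : RModel n) (p : M) :
    cov (fun q => frameMap X q c) p = 0 := by
  ext1 a
  apply hX.coframe_injective p
  rw [hX.coframe_cov (hX.isDiffField_frameMap c p)]
  simp only [hX.coframe_frameMap, mvfderiv_const]
  exact (map_zero (coframe X p)).symm

/-- In T(Y,Z) = ∇_Y Z − ∇_Z Y − [Y,Z], the torsion and both covariant derivatives vanish. -/
theorem IsGenerator.mlieBracket_frameMap (hX : IsGenerator cov L X)
    (htor : ∀ p, cov.torsion p = 0) (b c : RModel n) (p : M) :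
    VectorField.mlieBracket (𝓡 n) (fun q => frameMap X q b) (fun q => frameMap X q c) p = 0 := by
  have h := cov.torsion_apply (hX.isDiffField_frameMap b p) (hX.isDiffField_frameMap c p)
  rw [htor, hX.cov_frameMap, hX.cov_frameMap] at h
  simpa using h.symm

theorem mpullback_extChartAt_symm_frameMap (X : Fin n → Π p : M, TangentSpace (𝓡 n) p) {p₀ : M}
    {y : RModel n} (hy : y ∈ (extChartAt (𝓡 n) p₀).target) (c : RModel n) :
    VectorField.mpullback 𝓘(ℝ, RModel n) (𝓡 n) (extChartAt (𝓡 n) p₀).symm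
      (fun q => frameMap X q c) y = trivFrame X p₀ ((extChartAt (𝓡 n) p₀).symm y) c := by
  have hq : (extChartAt (𝓡 n) p₀).symm y ∈ (chartAt (RModel n) p₀).source := by
    rw [← extChartAt_source (𝓡 n)]
    exact (extChartAt (𝓡 n) p₀).map_target hy
  have h1 := mfderiv_extChartAt_comp_mfderivWithin_extChartAt_symm hy
  have h2 := mfderivWithin_extChartAt_symm_comp_mfderiv_extChartAt hy
  rw [ModelWithCorners.range_eq_univ, mfderivWithin_univ] at h1 h2
  rw [VectorField.mpullback_apply, ContinuousLinearMap.inverse_eq h2 h1, trivFrame_eq X hq,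
    TangentBundle.continuousLinearMapAt_trivializationAt hq]
  rfl

/-- The frame in the chart at `p₀`. -/
def chartFrame (X : Fin n → Π p : M, TangentSpace (𝓡 n) p) (p₀ : M) (y : RModel n) :
    RModel n →L[ℝ] RModel n :=
  trivFrame X p₀ ((extChartAt (𝓡 n) p₀).symm y)

/-- The coframe in the chart at `p₀`. -/
def chartCoframe (X : Fin n → Π p : M, TangentSpace (𝓡 n) p) (p₀ : M) (y : RModel n) :
    RModel n →L[ℝ] RModel n :=
  trivCoframe X p₀ ((extChartAt (𝓡 n) p₀).symm y)

theorem extChartAt_symm_mem_source {p₀ : M} {y : RModel n}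
    (hy : y ∈ (extChartAt (𝓡 n) p₀).target) :
    (extChartAt (𝓡 n) p₀).symm y ∈ (chartAt (RModel n) p₀).source := by
  rw [← extChartAt_source (𝓡 n)]
  exact (extChartAt (𝓡 n) p₀).map_target hy

theorem contMDiffAt_extChartAt_symm_of_mem {p₀ : M} {y : RModel n}
    (hy : y ∈ (extChartAt (𝓡 n) p₀).target) :
    ContMDiffAt 𝓘(ℝ, RModel n) (𝓡 n) ∞ (extChartAt (𝓡 n) p₀).symm y :=
  (contMDiffOn_extChartAt_symm p₀).contMDiffAt ((isOpen_extChartAt_target p₀).mem_nhds hy)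

theorem IsGenerator.contDiffAt_chartFrame (hX : IsGenerator cov L X) {p₀ : M} {y : RModel n}
    (hy : y ∈ (extChartAt (𝓡 n) p₀).target) : ContDiffAt ℝ ∞ (chartFrame X p₀) y :=
  ((hX.contMDiffAt_trivFrame (extChartAt_symm_mem_source hy)).comp y
    (contMDiffAt_extChartAt_symm_of_mem hy)).contDiffAt

theorem IsGenerator.contDiffAt_chartCoframe (hX : IsGenerator cov L X) {p₀ : M} {y : RModel n}
    (hy : y ∈ (extChartAt (𝓡 n) p₀).target) : ContDiffAt ℝ ∞ (chartCoframe X p₀) y :=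
  ((hX.contMDiffAt_trivCoframe (extChartAt_symm_mem_source hy)).comp y
    (contMDiffAt_extChartAt_symm_of_mem hy)).contDiffAt

theorem mlieBracket_eq_lieBracket {E : Type*} [NormedAddCommGroup E] [NormedSpace ℝ E]
    (V W : E → E) (x : E) :
    VectorField.mlieBracket 𝓘(ℝ, E) V W x = VectorField.lieBracket ℝ V W x := by
  have h := congrFun (VectorField.mlieBracketWithin_eq_lieBracketWithin (𝕜 := ℝ) (V := V) (W := W)
    (s := Set.univ)) x
  rw [VectorField.lieBracketWithin_univ] at h
  exact h

/-- Vanishing of the Lie bracket of two constant combinations of the frame, written out in a chart.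
-/
theorem IsGenerator.fderiv_chartFrame_symm (hX : IsGenerator cov L X)
    (htor : ∀ p, cov.torsion p = 0) {p₀ : M} {y : RModel n}
    (hy : y ∈ (extChartAt (𝓡 n) p₀).target) (b c : RModel n) :
    fderiv ℝ (chartFrame X p₀) y (chartFrame X p₀ y b) c
      = fderiv ℝ (chartFrame X p₀) y (chartFrame X p₀ y c) b := by
  have : IsManifold (𝓡 n) (minSmoothness ℝ 2) M := by
    rw [minSmoothness_of_isRCLikeNormedField]
    infer_instance
  have h := VectorField.mpullback_mlieBracket (I := 𝓘(ℝ, RModel n)) (I' := 𝓡 n) (n := ∞)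
    (f := (extChartAt (𝓡 n) p₀).symm) (x₀ := y)
    (hX.isDiffField_frameMap b _) (hX.isDiffField_frameMap c _)
    (contMDiffAt_extChartAt_symm_of_mem hy) (by
      rw [minSmoothness_of_isRCLikeNormedField]
      exact WithTop.coe_le_coe.2 le_top)
  have ev : ∀ b : RModel n, VectorField.mpullback 𝓘(ℝ, RModel n) (𝓡 n) (extChartAt (𝓡 n) p₀).symm
      (fun q => frameMap X q b) =ᶠ[𝓝 y] fun z => chartFrame X p₀ z b := fun b => by
    filter_upwards [(isOpen_extChartAt_target p₀).mem_nhds hy] with z hz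
    exact mpullback_extChartAt_symm_frameMap X hz b
  rw [(ev b).mlieBracket_vectorField_eq (ev c), VectorField.mpullback_apply,
    hX.mlieBracket_frameMap htor, map_zero] at h
  have h' := h.trans (mlieBracket_eq_lieBracket (fun z => chartFrame X p₀ z b)
    (fun z => chartFrame X p₀ z c) y)
  rw [VectorField.lieBracket] at h'
  have hd := (hX.contDiffAt_chartFrame hy).differentiableAt (by simp)
  have hfd : ∀ b a : RModel n, fderiv ℝ (fun z => chartFrame X p₀ z b) y a
      = fderiv ℝ (chartFrame X p₀) y a b := fun b a => by
    rw [fderiv_clm_apply hd (differentiableAt_const b)]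
    simp
  rw [hfd, hfd] at h'
  exact sub_eq_zero.1 h'.symm

theorem IsGenerator.chartCoframe_chartFrame (hX : IsGenerator cov L X) {p₀ : M} {y : RModel n}
    (hy : y ∈ (extChartAt (𝓡 n) p₀).target) :
    (chartCoframe X p₀ y).comp (chartFrame X p₀ y) = ContinuousLinearMap.id ℝ (RModel n) :=
  (hX.isInvertible_trivFrame (extChartAt_symm_mem_source hy)).inverse_comp_self

/-- The coframe is a closed one-form. Differentiating CF = id for the coframe C and the frame F
gives dC(Fα)(Fβ) = −C(dF(Fα)β), and the right side is symmetric in α, β because the frame fields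
commute. -/
theorem IsGenerator.fderiv_chartCoframe_symm (hX : IsGenerator cov L X)
    (htor : ∀ p, cov.torsion p = 0) {p₀ : M} {y : RModel n}
    (hy : y ∈ (extChartAt (𝓡 n) p₀).target) (a b : RModel n) :
    fderiv ℝ (chartCoframe X p₀) y a b = fderiv ℝ (chartCoframe X p₀) y b a := by
  have hinv := hX.isInvertible_trivFrame (extChartAt_symm_mem_source hy)
  obtain ⟨α, rfl⟩ : ∃ α, chartFrame X p₀ y α = a := hinv.surjective a
  obtain ⟨β, rfl⟩ : ∃ β, chartFrame X p₀ y β = b := hinv.surjective b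
  have hd := (hX.contDiffAt_chartFrame hy).differentiableAt (by simp)
  have hd' := (hX.contDiffAt_chartCoframe hy).differentiableAt (by simp)
  have key : ∀ α β : RModel n, fderiv ℝ (chartCoframe X p₀) y (chartFrame X p₀ y α)
      (chartFrame X p₀ y β)
      = -chartCoframe X p₀ y (fderiv ℝ (chartFrame X p₀) y (chartFrame X p₀ y α) β) := by
    intro α β
    have h0 : fderiv ℝ (fun z => (chartCoframe X p₀ z).comp (chartFrame X p₀ z)) y = 0 := by
      have : (fun z => (chartCoframe X p₀ z).comp (chartFrame X p₀ z)) =ᶠ[𝓝 y]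
          fun _ => ContinuousLinearMap.id ℝ (RModel n) := by
        filter_upwards [(isOpen_extChartAt_target p₀).mem_nhds hy] with z hz
        exact hX.chartCoframe_chartFrame hz
      rw [this.fderiv_eq, fderiv_const_apply]
    rw [fderiv_clm_comp hd' hd] at h0
    have := congrArg (fun T => T (chartFrame X p₀ y α) β) h0
    simp at this
    rw [eq_neg_iff_add_eq_zero, add_comm]
    exact this
  rw [key, key, hX.fderiv_chartFrame_symm htor hy]

/-- The coframe in the chart at `p₀` has a primitive near `p₀`, since parallel fields of a
torsion-free connection commute. -/
theorem IsGenerator.exists_primitive (hX : IsGenerator cov L X)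
    (htor : ∀ p, cov.torsion p = 0) (p₀ : M) :
    ∃ (B : Set (RModel n)) (x : RModel n → RModel n), IsOpen B ∧ extChartAt (𝓡 n) p₀ p₀ ∈ B ∧
      B ⊆ (extChartAt (𝓡 n) p₀).target ∧ ContDiffOn ℝ ∞ x B ∧
      ∀ y ∈ B, HasFDerivAt x (chartCoframe X p₀ y) y := by
  obtain ⟨r, hr, hB⟩ := Metric.isOpen_iff.1 (isOpen_extChartAt_target (I := 𝓡 n) p₀)
    (extChartAt (𝓡 n) p₀ p₀) (mem_extChartAt_target p₀)
  set B := Metric.ball (extChartAt (𝓡 n) p₀ p₀) r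
  have hC : ContDiffOn ℝ ∞ (chartCoframe X p₀) B := fun y hy =>
    (hX.contDiffAt_chartCoframe (hB hy)).contDiffWithinAt
  -- Poincaré lemma on a convex set: a one-form with symmetric derivative has a primitive.
  obtain ⟨x, hx⟩ := (convex_ball (extChartAt (𝓡 n) p₀ p₀)
    r).exists_forall_hasFDerivAt_of_fderiv_symmetric Metric.isOpen_ball
    (hC.differentiableOn (by simp)) (fun y hy a b => hX.fderiv_chartCoframe_symm htor (hB hy) a b)
  refine ⟨B, x, Metric.isOpen_ball, Metric.mem_ball_self hr, hB, ?_, hx⟩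
  rw [contDiffOn_infty_iff_fderiv_of_isOpen Metric.isOpen_ball]
  exact ⟨fun y hy => (hx y hy).differentiableAt.differentiableWithinAt,
    hC.congr fun y hy => (hx y hy).fderiv⟩

theorem IsGenerator.isInvertible_chartCoframe (hX : IsGenerator cov L X) {p₀ : M} {y : RModel n}
    (hy : y ∈ (extChartAt (𝓡 n) p₀).target) : (chartCoframe X p₀ y).IsInvertible :=
  (hX.isInvertible_trivFrame (extChartAt_symm_mem_source hy)).inverse

/-- A parallel frame of a torsion-free connection comes from local coordinates. -/
theorem IsGenerator.exists_chart (hX : IsGenerator cov L X)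
    (htor : ∀ p, cov.torsion p = 0) (p₀ : M) :
    ∃ e ∈ IsManifold.maximalAtlas (𝓡 n) ∞ M, p₀ ∈ e.source ∧
      ∀ q ∈ e.source, mfderiv (𝓡 n) (𝓡 n) e q = coframe X q := by
  obtain ⟨B, x, hBo, hpB, hBt, hxs, hx⟩ := hX.exists_primitive htor p₀
  have hxAt : ∀ y ∈ B, ContDiffAt ℝ ∞ x y := fun y hy => (hxs y hy).contDiffAt (hBo.mem_nhds hy)
  have hxe : ∀ y ∈ B, ∃ E : RModel n ≃L[ℝ] RModel n,
      HasFDerivAt x (E : RModel n →L[ℝ] RModel n) y := fun y hy => by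
    obtain ⟨E, hE⟩ := hX.isInvertible_chartCoframe (hBt hy)
    exact ⟨E, hE ▸ hx y hy⟩
  obtain ⟨E, hE⟩ := hxe _ hpB
  -- Inverse function theorem at the centre. Restricting to `B`, where the derivative of x is
  -- invertible at every point, makes the inverse smooth on the whole target.
  set g := ((hxAt _ hpB).toOpenPartialHomeomorph x hE (by simp)).restrOpen B hBo
  have hgB : g.source ⊆ B := fun y hy => hy.2
  have hpg : extChartAt (𝓡 n) p₀ p₀ ∈ g.source :=
    ⟨(hxAt _ hpB).mem_toOpenPartialHomeomorph_source hE (by simp), hpB⟩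
  have hgs : ContDiffOn ℝ ∞ g.symm g.target := fun z hz => by
    obtain ⟨E, hE⟩ := hxe _ (hgB (g.map_target hz))
    exact (g.contDiffAt_symm hz hE (hxAt _ (hgB (g.map_target hz)))).contDiffWithinAt
  set φ := chartAt (RModel n) p₀
  refine ⟨φ.trans g, ?_, ?_, ?_⟩
  · apply OpenPartialHomeomorph.mem_maximalAtlas_of_contMDiffOn
    · refine ContMDiffOn.comp (t := g.source) (hxs.mono hgB).contMDiffOn
        ((contMDiffOn_chart (I := 𝓡 n) (n := ∞) (x := p₀)).mono ?_) ?_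
      · exact fun q hq => hq.1
      · exact fun q hq => hq.2
    · refine ContMDiffOn.comp (g := φ.symm) (f := g.symm) (t := φ.target)
        contMDiffOn_chart_symm (hgs.contMDiffOn.mono ?_) ?_
      · exact fun q hq => hq.1
      · exact fun q hq => hq.2
  · exact ⟨mem_chart_source _ _, hpg⟩
  · intro q hq
    have hq1 : q ∈ φ.source := hq.1
    have hq2 : φ q ∈ g.source := hq.2
    have h1 : HasMFDerivAt (𝓡 n) 𝓘(ℝ, RModel n) (extChartAt (𝓡 n) p₀) q
        (mfderiv (𝓡 n) 𝓘(ℝ, RModel n) (extChartAt (𝓡 n) p₀) q) :=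
      (mdifferentiableAt_extChartAt hq1).hasMFDerivAt
    have h2 : HasMFDerivAt 𝓘(ℝ, RModel n) 𝓘(ℝ, RModel n) x (extChartAt (𝓡 n) p₀ q)
        (chartCoframe X p₀ (extChartAt (𝓡 n) p₀ q)) :=
      (hx _ (hgB hq2)).hasMFDerivAt
    have h3 := (h2.comp q h1).mfderiv
    refine Eq.trans h3 ?_
    ext1 v
    rw [← TangentBundle.continuousLinearMapAt_trivializationAt hq1]
    have h4 := hX.coframe_eq (p₀ := p₀) (u := ⟨q, v⟩) hq1
    have h5 : (extChartAt (𝓡 n) p₀).symm (extChartAt (𝓡 n) p₀ q) = q :=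
      (extChartAt (𝓡 n) p₀).left_inv (by rwa [extChartAt_source])
    refine Eq.trans ?_ h4.symm
    have h6 : chartCoframe X p₀ (extChartAt (𝓡 n) p₀ q) = trivCoframe X p₀ q := by
      rw [chartCoframe, h5]
    rw [h6]
    have hq' : q ∈ (trivializationAt (RModel n) (TangentSpace (𝓡 n)) p₀).baseSet := hq1
    exact congrArg (trivCoframe X p₀ q)
      (congrFun (Bundle.Trivialization.coe_linearMapAt_of_mem (R := ℝ) _ hq') v)

/-- Coordinate fields of an adapted chart are constant combinations of the frame, hence parallel;
this is what makes the chart affine. -/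
theorem coordField_eq_frameMap (hX : IsGenerator cov L X) {e : OpenPartialHomeomorph M (RModel n)}
    {q : M} (hq : mfderiv (𝓡 n) (𝓡 n) e q = coframe X q) (v : RModel n) :
    coordField e v q = frameMap X q v := by
  have h : coordField e v q = (coframe X q).inverse v := congrArg (fun T => T.inverse v) hq
  rw [h, (hX.isInvertible_coframe q).inverse_apply_eq, hX.coframe_frameMap]

theorem mdifferentiable_of_mem_maximalAtlas {e : OpenPartialHomeomorph M (RModel n)}
    (he : e ∈ IsManifold.maximalAtlas (𝓡 n) ∞ M) : e.MDifferentiable (𝓡 n) (𝓡 n) :=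
  ⟨(contMDiffOn_of_mem_maximalAtlas he).mdifferentiableOn (by simp),
    (contMDiffOn_symm_of_mem_maximalAtlas he).mdifferentiableOn (by simp)⟩

theorem isInvertible_mfderiv_of_mem_maximalAtlas {e : OpenPartialHomeomorph M (RModel n)}
    (he : e ∈ IsManifold.maximalAtlas (𝓡 n) ∞ M) {q : M} (hq : q ∈ e.source) :
    (mfderiv (𝓡 n) (𝓡 n) e q).IsInvertible :=
  ⟨(mdifferentiable_of_mem_maximalAtlas he).mfderiv hq, rfl⟩

theorem isDiffField_coordField {e : OpenPartialHomeomorph M (RModel n)}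
    (he : e ∈ IsManifold.maximalAtlas (𝓡 n) ∞ M) (v : RModel n) {q : M} (hq : q ∈ e.source) :
    IsDiffField (coordField e v) q := by
  have hV : MDifferentiableAt (𝓡 n) (𝓡 n).tangent
      (fun y => (⟨y, v⟩ : TangentBundle (𝓡 n) (RModel n))) (e q) :=
    (contMDiffAt_vectorSpace_iff_contDiffAt (n := ∞) (V := fun _ => v)
      |>.2 contDiffAt_const).mdifferentiableAt (by simp)
  exact MDifferentiableAt.mpullback_vectorField (n := ∞) hV
    (contMDiffAt_of_mem_maximalAtlas he hq)
    (isInvertible_mfderiv_of_mem_maximalAtlas he hq) (WithTop.coe_le_coe.2 le_top)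

/-- A chart adapted to a parallel frame is affine. -/
theorem IsGenerator.isAffineChart (hX : IsGenerator cov L X)
    {e : OpenPartialHomeomorph M (RModel n)} (he : e ∈ IsManifold.maximalAtlas (𝓡 n) ∞ M)
    (hed : ∀ q ∈ e.source, mfderiv (𝓡 n) (𝓡 n) e q = coframe X q) : IsAffineChart cov e := by
  refine ⟨he, fun v w p hp => ?_⟩
  have h : cov (coordField e w) p = 0 := by
    rw [← hX.cov_frameMap w p]
    refine cov.isCovariantDerivativeOnUniv.congr_of_eventuallyEq (isDiffField_coordField he w hp)
      (hX.isDiffField_frameMap w p) Filter.univ_mem ?_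
    filter_upwards [e.open_source.mem_nhds hp] with q hq
    exact coordField_eq_frameMap hX (hed q hq) w
  rw [h]
  rfl

/-- Small affine charts adapted to a parallel frame. -/
theorem IsGenerator.exists_convex_chart (hX : IsGenerator cov L X)
    (htor : ∀ p, cov.torsion p = 0) {p₀ : M} {U : Set M} (hU : U ∈ 𝓝 p₀) :
    ∃ e : OpenPartialHomeomorph M (RModel n), IsAffineChart cov e ∧ p₀ ∈ e.source ∧
      e.source ⊆ U ∧ Convex ℝ e.target ∧
      ∀ q ∈ e.source, mfderiv (𝓡 n) (𝓡 n) e q = coframe X q := by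
  obtain ⟨e, he, hp, hed⟩ := hX.exists_chart htor p₀
  have hnhds : e.target ∩ e.symm ⁻¹' U ∈ 𝓝 (e p₀) :=
    Filter.inter_mem (e.open_target.mem_nhds (e.map_source hp))
      ((e.symm.continuousAt (e.map_source hp)).preimage_mem_nhds (by rwa [e.left_inv hp]))
  obtain ⟨r, hr, hB⟩ := Metric.mem_nhds_iff.1 hnhds
  set b := Metric.ball (e p₀) r
  have hbo : IsOpen b := Metric.isOpen_ball
  set e₁ := e.trans (OpenPartialHomeomorph.ofSet b hbo)
  have htgt : e₁.target = b := by
    ext y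
    exact ⟨fun hy => hy.1, fun hy => ⟨hy, (hB hy).1⟩⟩
  have hmem : e₁ ∈ IsManifold.maximalAtlas (𝓡 n) ∞ M := by
    apply OpenPartialHomeomorph.mem_maximalAtlas_of_contMDiffOn
    · exact (contMDiffOn_of_mem_maximalAtlas he).mono fun q hq => hq.1
    · exact (contMDiffOn_symm_of_mem_maximalAtlas he).mono fun q hq => hq.2
  have hed₁ : ∀ q ∈ e₁.source, mfderiv (𝓡 n) (𝓡 n) e₁ q = coframe X q := fun q hq => hed q hq.1
  refine ⟨e₁, hX.isAffineChart hmem hed₁, ⟨hp, Metric.mem_ball_self hr⟩, fun q hq => ?_,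
    htgt ▸ convex_ball _ _, hed₁⟩
  have h : e.symm (e q) ∈ U := (hB hq.2).2
  rwa [e.left_inv hq.1] at h

end AffineChart

/-! ### Affine maps, connectors, and constant matrices in parallel frames -/

section AffineMap

variable {n d : ℕ}
  {M : Type*} [TopologicalSpace M] [ChartedSpace (RModel n) M] [IsManifold (𝓡 n) ∞ M]
  {M' : Type*} [TopologicalSpace M'] [ChartedSpace (RModel d) M'] [IsManifold (𝓡 d) ∞ M']
  {cov : Conn n M} {L : Set (TangentBundle (𝓡 n) M)} {X : Fin n → Π p : M, TangentSpace (𝓡 n) p}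
  {cov' : Conn d M'} {L' : Set (TangentBundle (𝓡 d) M')}
  {X' : Fin d → Π p : M', TangentSpace (𝓡 d) p} {f : M → M'}

theorem mvfderiv_vector_comp_apply {E H N E' H' N' V : Type*} [NormedAddCommGroup E]
    [NormedSpace ℝ E] [TopologicalSpace H] {I : ModelWithCorners ℝ E H} [TopologicalSpace N]
    [ChartedSpace H N] [NormedAddCommGroup E'] [NormedSpace ℝ E'] [TopologicalSpace H']
    {I' : ModelWithCorners ℝ E' H'} [TopologicalSpace N'] [ChartedSpace H' N']
    [NormedAddCommGroup V] [NormedSpace ℝ V] {g : N' → V} {f : N → N'} (x : N)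
    (hg : MDifferentiableAt I' 𝓘(ℝ, V) g (f x)) (hf : MDifferentiableAt I I' f x)
    (v : TangentSpace I x) :
    mvfderiv I (g ∘ f) x v = mvfderiv I' g (f x) (mfderiv I I' f x v) :=
  mfderiv_comp_apply x hg hf v

/-- In a chart the function has zero derivative on a ball, which is convex, so it is constant there.
-/
theorem eventually_eq_of_hasMFDerivAt_zero {V : Type*} [NormedAddCommGroup V] [NormedSpace ℝ V]
    {g : M → V} {p : M} (hg : ∀ᶠ q in 𝓝 p, HasMFDerivAt (𝓡 n) 𝓘(ℝ, V) g q 0) :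
    ∀ᶠ q in 𝓝 p, g q = g p := by
  set φ := extChartAt (𝓡 n) p
  have hnhds : φ.target ∩ φ.symm ⁻¹' {q | HasMFDerivAt (𝓡 n) 𝓘(ℝ, V) g q 0} ∈ 𝓝 (φ p) := by
    refine Filter.inter_mem ((isOpen_extChartAt_target p).mem_nhds (mem_extChartAt_target p)) ?_
    refine (continuousAt_extChartAt_symm p).preimage_mem_nhds ?_
    rw [extChartAt_to_inv]
    exact hg
  obtain ⟨r, hr, hB⟩ := Metric.mem_nhds_iff.1 hnhds
  have hd : ∀ y ∈ Metric.ball (φ p) r, HasFDerivAt (g ∘ φ.symm) (0 : RModel n →L[ℝ] V) y := by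
    intro y hy
    have h1 := ((contMDiffAt_extChartAt_symm_of_mem (hB hy).1).mdifferentiableAt
      (by simp)).hasMFDerivAt
    have h2 := HasMFDerivAt.comp y (hB hy).2 h1
    exact (h2.congr_mfderiv (ContinuousLinearMap.zero_comp _)).hasFDerivAt
  have hev : φ.source ∩ φ ⁻¹' Metric.ball (φ p) r ∈ 𝓝 p :=
    Filter.inter_mem (extChartAt_source_mem_nhds p)
      ((continuousAt_extChartAt p).preimage_mem_nhds (Metric.ball_mem_nhds _ hr))
  filter_upwards [hev] with q hq
  have h := (convex_ball (φ p) r).is_const_of_fderivWithin_eq_zero (𝕜 := ℝ) (f := g ∘ φ.symm)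
    (fun y hy => (hd y hy).differentiableAt.differentiableWithinAt)
    (fun y hy => by
      rw [fderivWithin_of_isOpen Metric.isOpen_ball hy, (hd y hy).fderiv])
    hq.2 (Metric.mem_ball_self hr)
  have h' : g (φ.symm (φ q)) = g (φ.symm (φ p)) := h
  rwa [φ.left_inv hq.1, φ.left_inv (mem_extChartAt_source p)] at h'

/-- Differentiate π' ∘ f_* = f ∘ π. The component along π is thus respected by any smooth f, and
only the connector component carries a condition. -/
theorem projDeriv_mfderiv_tangentMap (hf : ContMDiff (𝓡 n) (𝓡 d) ∞ f) (u : TangentBundle (𝓡 n) M)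
    (A : TangentSpace (𝓡 n).tangent u) :
    projDeriv (tangentMap (𝓡 n) (𝓡 d) f u)
        (mfderiv (𝓡 n).tangent (𝓡 d).tangent (tangentMap (𝓡 n) (𝓡 d) f) u A)
      = mfderiv (𝓡 n) (𝓡 d) f u.proj (projDeriv u A) := by
  have hT : MDifferentiableAt (𝓡 n).tangent (𝓡 d).tangent (tangentMap (𝓡 n) (𝓡 d) f) u :=
    (hf.contMDiff_tangentMap (m := ∞) (by simp)).mdifferentiable (by simp) u
  have hπ' := (Bundle.contMDiff_proj (n := ∞) (IB := 𝓡 d)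
    (TangentSpace (𝓡 d) : M' → Type _)).mdifferentiable (by simp) (tangentMap (𝓡 n) (𝓡 d) f u)
  have hπ := (Bundle.contMDiff_proj (n := ∞) (IB := 𝓡 n)
    (TangentSpace (𝓡 n) : M → Type _)).mdifferentiable (by simp) u
  have hfu := hf.mdifferentiable (by simp) u.proj
  have h1 := (hπ'.hasMFDerivAt.comp u hT.hasMFDerivAt).mfderiv
  have h2 := (hfu.hasMFDerivAt.comp u hπ.hasMFDerivAt).mfderiv
  exact congrArg (fun T => T A) (h1.symm.trans h2)

/-- In parallel frames, the differential of `f` has the constant matrix `a`. -/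
def HasFrameMatrix (X : Fin n → Π p : M, TangentSpace (𝓡 n) p)
    (X' : Fin d → Π p : M', TangentSpace (𝓡 d) p) (f : M → M') (a : RModel n →L[ℝ] RModel d) :
    Prop :=
  ∀ u, frameCoord X' (tangentMap (𝓡 n) (𝓡 d) f u) = a (frameCoord X u)

/-- The differential of `f` is compatible with the connectors. -/
def CommutesWithConnectors (cov : Conn n M) (cov' : Conn d M') (f : M → M') : Prop :=
  ∀ (u : TangentBundle (𝓡 n) M) (A : TangentSpace (𝓡 n).tangent u),
    connector cov' (tangentMap (𝓡 n) (𝓡 d) f u)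
        (mfderiv (𝓡 n).tangent (𝓡 d).tangent (tangentMap (𝓡 n) (𝓡 d) f) u A)
      = mfderiv (𝓡 n) (𝓡 d) f u.proj (connector cov u A)

theorem IsGenerator.mvfderiv_frameCoord_tangentMap (hX' : IsGenerator cov' L' X')
    (hf : ContMDiff (𝓡 n) (𝓡 d) ∞ f) (u : TangentBundle (𝓡 n) M)
    (A : TangentSpace (𝓡 n).tangent u) :
    mvfderiv (𝓡 n).tangent (frameCoord X' ∘ tangentMap (𝓡 n) (𝓡 d) f) u A
      = coframe X' (tangentMap (𝓡 n) (𝓡 d) f u).proj (connector cov' (tangentMap (𝓡 n) (𝓡 d) f u)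
        (mfderiv (𝓡 n).tangent (𝓡 d).tangent (tangentMap (𝓡 n) (𝓡 d) f) u A)) := by
  have hT : MDifferentiableAt (𝓡 n).tangent (𝓡 d).tangent (tangentMap (𝓡 n) (𝓡 d) f) u :=
    (hf.contMDiff_tangentMap (m := ∞) (by simp)).mdifferentiable (by simp) u
  exact (mvfderiv_vector_comp_apply (g := frameCoord X') u
    (hX'.contMDiff_frameCoord.mdifferentiable (by simp) _) hT A).trans (hX'.mvfderiv_frameCoord _ _)

/-- Differentiate θ' ∘ f_* = a ∘ θ: both sides become coframes of connectors, and the coframe of X'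
is injective. -/
theorem HasFrameMatrix.commutesWithConnectors (hX : IsGenerator cov L X)
    (hX' : IsGenerator cov' L' X') (hf : ContMDiff (𝓡 n) (𝓡 d) ∞ f)
    {a : RModel n →L[ℝ] RModel d} (ha : HasFrameMatrix X X' f a) :
    CommutesWithConnectors cov cov' f := by
  intro u A
  apply hX'.coframe_injective
  refine (hX'.mvfderiv_frameCoord_tangentMap hf u A).symm.trans ?_
  have h : frameCoord X' ∘ tangentMap (𝓡 n) (𝓡 d) f = a ∘ frameCoord X := funext ha
  rw [h]
  have h1 := hX.contMDiff_frameCoord.mdifferentiable (by simp) u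
  have h2 : mvfderiv (𝓡 n).tangent (a ∘ frameCoord X) u A
      = a (mvfderiv (𝓡 n).tangent (frameCoord X) u A) :=
    congrArg (fun T => T A) (a.hasMFDerivAt.comp u h1.hasMFDerivAt).mfderiv
  rw [h2, hX.mvfderiv_frameCoord]
  exact (ha ⟨u.proj, connector cov u A⟩).symm

/-- The field `X_c` along `f`, in the frame `X'`. -/
def pushCoord (X : Fin n → Π p : M, TangentSpace (𝓡 n) p)
    (X' : Fin d → Π p : M', TangentSpace (𝓡 d) p) (f : M → M') (c : RModel n) (p : M) :
    RModel d :=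
  frameCoord X' (tangentMap (𝓡 n) (𝓡 d) f ⟨p, frameMap X p c⟩)

/-- On a connected manifold the locally constant coefficients are constant, so the matrix can be
read off at one base point. -/
theorem exists_hasFrameMatrix [PreconnectedSpace M] [Nonempty M] (hX : IsGenerator cov L X)
    (h : ∀ c p, ∀ᶠ q in 𝓝 p, pushCoord X X' f c q = pushCoord X X' f c p) :
    ∃ a, HasFrameMatrix X X' f a := by
  obtain ⟨p₀⟩ := ‹Nonempty M›
  refine ⟨(coframe X' (f p₀)).comp ((mfderiv (𝓡 n) (𝓡 d) f p₀).comp (frameMap X p₀)), ?_⟩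
  intro u
  have hc : IsLocallyConstant (pushCoord X X' f (frameCoord X u)) :=
    (IsLocallyConstant.iff_eventually_eq _).2 (h _)
  have h2 := hc.apply_eq_of_preconnectedSpace u.proj p₀
  refine Eq.trans ?_ h2
  have h3 : frameMap X u.proj (frameCoord X u) = u.2 := hX.frameMap_coframe u.proj u.2
  rw [pushCoord, h3]

/-- Along the section X_c the map θ is constant, so the connector kills the differential of the
section. Intertwining carries this to f_* X_c, whose coefficients then have zero derivative. -/
theorem CommutesWithConnectors.pushCoord_eventually_eq (hX : IsGenerator cov L X)
    (hX' : IsGenerator cov' L' X') (hf : ContMDiff (𝓡 n) (𝓡 d) ∞ f)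
    (hc : CommutesWithConnectors cov cov' f) (c : RModel n) (p : M) :
    ∀ᶠ q in 𝓝 p, pushCoord X X' f c q = pushCoord X X' f c p := by
  refine eventually_eq_of_hasMFDerivAt_zero (n := n) (Filter.Eventually.of_forall fun q => ?_)
  have hs := hX.isDiffField_frameMap c q
  have hT : MDifferentiableAt (𝓡 n).tangent 𝓘(ℝ, RModel d)
      (frameCoord X' ∘ tangentMap (𝓡 n) (𝓡 d) f) ⟨q, frameMap X q c⟩ :=
    (hX'.contMDiff_frameCoord.comp (hf.contMDiff_tangentMap (m := ∞) (by simp))).mdifferentiable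
      (by simp) _
  refine (hT.hasMFDerivAt.comp q hs.hasMFDerivAt).congr_mfderiv ?_
  ext1 v
  set A := mfderiv (𝓡 n) (𝓡 n).tangent
    (fun q => (⟨q, frameMap X q c⟩ : TangentBundle (𝓡 n) M)) q v
  have h1 := hX'.mvfderiv_frameCoord_tangentMap hf ⟨q, frameMap X q c⟩ A
  have h2 : connector cov ⟨q, frameMap X q c⟩ A = 0 := by
    apply hX.coframe_injective
    refine (hX.mvfderiv_frameCoord ⟨q, frameMap X q c⟩ A).symm.trans ?_
    have h3 : frameCoord X ∘ (fun q => (⟨q, frameMap X q c⟩ : TangentBundle (𝓡 n) M))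
        = fun _ => c := funext fun q => hX.coframe_frameMap q c
    have h4 := mvfderiv_vector_comp_apply (g := frameCoord X) q
      (hX.contMDiff_frameCoord.mdifferentiable (by simp) _) hs v
    rw [h3, mvfderiv_const] at h4
    refine h4.symm.trans (map_zero (coframe X q)).symm
  rw [hc, h2, map_zero] at h1
  exact h1.trans (map_zero (coframe X' (f q)))

theorem mfderiv_coordField {e : OpenPartialHomeomorph M (RModel n)}
    (he : e ∈ IsManifold.maximalAtlas (𝓡 n) ∞ M) {q : M} (hq : q ∈ e.source) (v : RModel n) :
    mfderiv (𝓡 n) (𝓡 n) e q (coordField e v q) = v :=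
  (isInvertible_mfderiv_of_mem_maximalAtlas he hq).self_apply_inverse v

theorem coordField_mfderiv {e : OpenPartialHomeomorph M (RModel n)}
    (he : e ∈ IsManifold.maximalAtlas (𝓡 n) ∞ M) {q : M} (hq : q ∈ e.source)
    (a : TangentSpace (𝓡 n) q) :
    coordField e (mfderiv (𝓡 n) (𝓡 n) e q a) q = a :=
  (isInvertible_mfderiv_of_mem_maximalAtlas he hq).inverse_apply_self a

/-- Coordinate fields of an affine chart are parallel, and a parallel field has locally constant
coefficients in a parallel frame. -/
theorem IsGenerator.coframe_coordField_eventually_eq (hX : IsGenerator cov L X)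
    {e : OpenPartialHomeomorph M (RModel n)} (he : IsAffineChart cov e) (v : RModel n) {p : M}
    (hp : p ∈ e.source) :
    ∀ᶠ q in 𝓝 p, coframe X q (coordField e v q) = coframe X p (coordField e v p) := by
  refine eventually_eq_of_hasMFDerivAt_zero (n := n) (g := fun q => coframe X q (coordField e v q))
    ?_
  filter_upwards [e.open_source.mem_nhds hp] with q hq
  have hd := isDiffField_coordField he.1 v hq
  refine (hX.mdifferentiableAt_coframe hd).hasMFDerivAt.congr_mfderiv ?_
  ext1 a
  refine (hX.coframe_cov hd a).symm.trans ?_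
  have h := he.2 (mfderiv (𝓡 n) (𝓡 n) e q a) v q hq
  rw [coordField_mfderiv he.1 hq] at h
  rw [h, map_zero]
  rfl

/-- In affine charts f sends the constant field v to the constant field given by the linear part of
A; on both sides constant fields have locally constant frame coefficients. -/
theorem IsAffineMap.pushCoord_eventually_eq (hX : IsGenerator cov L X)
    (hX' : IsGenerator cov' L' X') (hf : ContMDiff (𝓡 n) (𝓡 d) ∞ f)
    (haff : IsAffineMap cov cov' f) (c : RModel n) (p : M) :
    ∀ᶠ q in 𝓝 p, pushCoord X X' f c q = pushCoord X X' f c p := by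
  obtain ⟨e, e', he, he', hp, hsub, A, hA⟩ := haff p
  have hfe : ∀ q ∈ e.source, f q ∈ e'.source := fun q hq => hsub ⟨q, hq, rfl⟩
  -- The constant field of `e` that agrees with X_c at p. Having locally constant frame
  -- coefficients, it agrees with X_c near p.
  set v : RModel n := mfderiv (𝓡 n) (𝓡 n) e p (frameMap X p c) with hv
  have hvp : coordField e v p = frameMap X p c := coordField_mfderiv he.1 hp _
  set A' : RModel n →L[ℝ] RModel d := LinearMap.toContinuousLinearMap A.linear
  have hAc : (A : RModel n → RModel d) = fun y => A' y + A 0 := by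
    funext y
    exact congrFun A.decomp y
  have hpush : ∀ q ∈ e.source,
      mfderiv (𝓡 n) (𝓡 d) f q (coordField e v q) = coordField e' (A' v) (f q) := by
    intro q hq
    refine ((isInvertible_mfderiv_of_mem_maximalAtlas he'.1 (hfe q hq)).inverse_apply_eq.2 ?_).symm
    have h1 : HasMFDerivAt (𝓡 n) 𝓘(ℝ, RModel d) (e' ∘ f) q
        ((mfderiv (𝓡 d) (𝓡 d) e' (f q)).comp (mfderiv (𝓡 n) (𝓡 d) f q)) :=
      ((mdifferentiable_of_mem_maximalAtlas he'.1).mdifferentiableAt (hfe q hq)).hasMFDerivAt.comp q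
        (hf.mdifferentiable (by simp) q).hasMFDerivAt
    have hA' : HasFDerivAt A A' (e q) := by
      rw [hAc]
      exact A'.hasFDerivAt.add_const _
    have h2 : HasMFDerivAt (𝓡 n) 𝓘(ℝ, RModel d) (A ∘ e) q
        (A'.comp (mfderiv (𝓡 n) (𝓡 n) e q)) :=
      hA'.hasMFDerivAt.comp q 
        ((mdifferentiable_of_mem_maximalAtlas he.1).mdifferentiableAt hq).hasMFDerivAt
    have hev : e' ∘ f =ᶠ[𝓝 q] A ∘ e := by
      filter_upwards [e.open_source.mem_nhds hq] with z hz
      have := hA (e z) (e.map_source hz)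
      rw [e.left_inv hz] at this
      exact this
    have h3 := hasMFDerivAt_unique h1 (h2.congr_of_eventuallyEq hev)
    have h4 := congrArg (fun T => T (coordField e v q)) h3
    refine Eq.trans ?_ h4.symm
    exact (congrArg A' (mfderiv_coordField he.1 hq v)).symm
  have key : ∀ᶠ q in 𝓝 p, pushCoord X X' f c q
      = coframe X' (f p) (coordField e' (A' v) (f p)) := by
    filter_upwards [e.open_source.mem_nhds hp, hX.coframe_coordField_eventually_eq he v hp,
      (hf.continuous.tendsto p).eventually
        (hX'.coframe_coordField_eventually_eq he' (A' v) (hfe p hp))] with q hq h1 h2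
    have h3 : coordField e v q = frameMap X q c := by
      apply hX.coframe_injective
      rw [h1, hvp, hX.coframe_frameMap, hX.coframe_frameMap]
    have h4 := hpush q hq
    rw [h3] at h4
    exact (congrArg (coframe X' (f q)) h4).trans h2
  filter_upwards [key] with q hq
  rw [hq, key.self_of_nhds]

/-- In charts adapted to the two frames the expression of f has derivative a at every point, so on a
convex target it differs from a by a constant. -/
theorem HasFrameMatrix.isAffineMap (hX : IsGenerator cov L X)
    (hX' : IsGenerator cov' L' X') (htor : ∀ p, cov.torsion p = 0)
    (htor' : ∀ p, cov'.torsion p = 0) (hf : ContMDiff (𝓡 n) (𝓡 d) ∞ f)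
    {a : RModel n →L[ℝ] RModel d} (ha : HasFrameMatrix X X' f a) : IsAffineMap cov cov' f := by
  intro p
  obtain ⟨e', he', hp', -, -, hed'⟩ :=
    hX'.exists_convex_chart htor' (Filter.univ_mem (f := 𝓝 (f p)))
  obtain ⟨e, he, hp, hsub, hconv, hed⟩ := hX.exists_convex_chart htor
    (hf.continuous.continuousAt.preimage_mem_nhds (e'.open_source.mem_nhds hp'))
  refine ⟨e, e', he, he', hp, Set.image_subset_iff.2 hsub, ?_⟩
  have hd : ∀ y ∈ e.target, HasFDerivAt (fun y => e' (f (e.symm y))) a y := by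
    intro y hy
    have hq := e.map_target hy
    have hm := mdifferentiable_of_mem_maximalAtlas he.1
    have h1 := (hm.mdifferentiableAt_symm hy).hasMFDerivAt
    have h2 := (hf.mdifferentiable (by simp) (e.symm y)).hasMFDerivAt
    have h3 :=
      ((mdifferentiable_of_mem_maximalAtlas he'.1).mdifferentiableAt (hsub hq)).hasMFDerivAt
    refine HasMFDerivAt.hasFDerivAt ((h3.comp y (h2.comp y h1)).congr_mfderiv ?_)
    ext1 w
    set D := mfderiv (𝓡 n) (𝓡 n) e.symm y w with hD
    have h4 : coframe X (e.symm y) D = w := by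
      have h := congrArg (fun T => T w) (hm.comp_symm_deriv hy)
      rw [hed _ hq] at h
      exact h
    have h5 := ha ⟨e.symm y, D⟩
    have h6 : frameCoord X ⟨e.symm y, D⟩ = w := h4
    rw [h6] at h5
    refine Eq.trans ?_ h5
    exact congrArg (fun T => T (mfderiv (𝓡 n) (𝓡 d) f (e.symm y) D)) (hed' _ (hsub hq))
  refine ⟨(a : RModel n →ₗ[ℝ] RModel d).toAffineMap
    + AffineMap.const ℝ (RModel n) (e' (f (e.symm (e p))) - a (e p)), fun y hy => ?_⟩
  have h := hconv.is_const_of_fderivWithin_eq_zero (𝕜 := ℝ)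
    (f := fun y => e' (f (e.symm y)) - a y)
    (fun z hz => ((hd z hz).sub a.hasFDerivAt).differentiableAt.differentiableWithinAt)
    (fun z hz => by
      rw [fderivWithin_of_isOpen e.open_target hz, ((hd z hz).fun_sub a.hasFDerivAt).fderiv,
        sub_self])
    hy (e.map_source hp)
  exact (sub_eq_iff_eq_add'.1 h)

end AffineMap

/-! ### Torsion in closed subgroups of tori, and homomorphisms given by integral matrices -/

section Torus

open scoped Matrix

/-- A nontrivial closed subgroup of the circle contains a nontrivial torsion element. -/
theorem exists_torsion_of_closed_circle (s : AddSubgroup UnitAddCircle)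
    (hs : IsClosed (s : Set UnitAddCircle)) (hne : s ≠ ⊥) :
    ∃ a ∈ s, a ≠ 0 ∧ IsOfFinAddOrder a := by
  -- A dense closed subgroup is the whole circle and contains the class of 1/2; a subgroup that is
  -- not dense is generated by an element of finite order.
  by_cases hd : Dense (s : Set UnitAddCircle)
  · have htop : ∀ x, x ∈ s := fun x => by
      have := hd x
      rwa [hs.closure_eq] at this
    have ho : addOrderOf (((1 / (2 : ℕ) : ℝ)) : UnitAddCircle) = 2 :=
      AddCircle.addOrderOf_period_div (p := (1 : ℝ)) two_pos
    refine ⟨(((1 / (2 : ℕ) : ℝ)) : UnitAddCircle), htop _, ?_, ?_⟩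
    · intro h
      rw [h, addOrderOf_zero] at ho
      omega
    · rw [← addOrderOf_pos_iff, ho]
      exact two_pos
  · rw [AddCircle.dense_addSubgroup_iff_ne_zmultiples] at hd
    push Not at hd
    obtain ⟨a, ha, rfl⟩ := hd
    refine ⟨a, AddSubgroup.mem_zmultiples a, ?_, ?_⟩
    · rintro rfl
      exact hne (by simp)
    · exact addOrderOf_pos_iff.1 (Nat.pos_of_ne_zero ha)

/-- A nontrivial closed subgroup of a torus contains a nontrivial torsion element. -/
theorem exists_torsion_of_closed (n : ℕ) (H : AddSubgroup (Torus n))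
    (hH : IsClosed (H : Set (Torus n))) (hne : H ≠ ⊥) : ∃ a ∈ H, a ≠ 0 ∧ IsOfFinAddOrder a := by
  induction n with
  | zero =>
    exact absurd (H.eq_bot_iff_forall.2 fun x _ => Subsingleton.elim _ _) hne
  | succ n ih =>
    let ι : Torus n →+ Torus (n + 1) :=
      { toFun := fun c => Fin.cons 0 c
        map_zero' := by
          ext i
          refine Fin.cases ?_ (fun j => ?_) i <;> simp
        map_add' := fun a b => by
          ext i
          refine Fin.cases ?_ (fun j => ?_) i <;> simp }
    have hι : Continuous ι := by
      refine continuous_pi fun i => ?_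
      refine Fin.cases ?_ (fun j => ?_) i
      · exact continuous_const
      · exact continuous_apply j
    have hιinj : Function.Injective ι := fun a b h => by
      ext j
      exact congrFun h j.succ
    -- If the part of H with zero first coordinate is trivial, the first coordinate embeds H in the
    -- circle with compact image, and a torsion value comes from a torsion element. Otherwise the
    -- induction hypothesis applies to that part.
    by_cases hK : H.comap ι = ⊥
    · have hker : ∀ a ∈ H, a 0 = 0 → a = 0 := fun a ha h0 => by
        have h1 : ι (fun j => a j.succ) = a := by
          ext i
          refine Fin.cases ?_ (fun j => ?_) i
          · exact h0.symm
          · rfl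
        have h2 : (fun j => a j.succ) ∈ H.comap ι := by
          rw [AddSubgroup.mem_comap, h1]
          exact ha
        rw [hK, AddSubgroup.mem_bot] at h2
        rw [← h1, h2, map_zero]
      let ev : Torus (n + 1) →+ UnitAddCircle := Pi.evalAddMonoidHom (fun _ => UnitAddCircle) 0
      have hcl : IsClosed ((H.map ev : AddSubgroup UnitAddCircle) : Set UnitAddCircle) := by
        rw [AddSubgroup.coe_map]
        exact (hH.isCompact.image (continuous_apply 0)).isClosed
      obtain ⟨b, hb, hb0⟩ := H.bot_or_exists_ne_zero.resolve_left hne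
      have hne' : H.map ev ≠ ⊥ := fun h => by
        have : ev b ∈ H.map ev := ⟨b, hb, rfl⟩
        rw [h, AddSubgroup.mem_bot] at this
        exact hb0 (hker b hb this)
      obtain ⟨x, ⟨a, ha, rfl⟩, hx0, hx⟩ := exists_torsion_of_closed_circle _ hcl hne'
      refine ⟨a, ha, fun h => hx0 (by rw [h, map_zero]), ?_⟩
      rw [isOfFinAddOrder_iff_nsmul_eq_zero] at hx ⊢
      obtain ⟨k, hk, hk0⟩ := hx
      exact ⟨k, hk, hker _ (H.nsmul_mem ha k) hk0⟩
    · obtain ⟨a, ha, ha0, hfin⟩ := ih (H.comap ι) (hH.preimage hι) hK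
      exact ⟨ι a, ha, fun h => ha0 (hιinj (h.trans (map_zero ι).symm)), ι.isOfFinAddOrder hfin⟩

theorem finite_torus_nsmul_eq_zero (n : ℕ) {k : ℕ} (hk : 0 < k) :
    {a : Torus n | k • a = 0}.Finite := by
  refine (Set.Finite.pi' fun _ : Fin n => AddCircle.finite_torsion (p := (1 : ℝ)) hk).subset ?_
  intro a ha i
  exact congrFun ha i

theorem countable_torus_torsion (n : ℕ) : {a : Torus n | IsOfFinAddOrder a}.Countable := by
  refine (Set.countable_iUnion fun k : ℕ =>
    (finite_torus_nsmul_eq_zero n k.succ_pos).countable).mono ?_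
  intro a ha
  obtain ⟨k, hk, hk0⟩ := isOfFinAddOrder_iff_nsmul_eq_zero.1 ha
  refine Set.mem_iUnion.2 ⟨k - 1, ?_⟩
  rw [Set.mem_ofPred_eq, Nat.succ_eq_add_one, Nat.sub_add_cancel hk]
  exact hk0

theorem isOpenQuotientMap_torusMk (n : ℕ) : IsOpenQuotientMap (Torus.mk : (Fin n → ℝ) → Torus n) :=
  IsOpenQuotientMap.piMap fun _ => QuotientAddGroup.isOpenQuotientMap_mk

theorem torusMk_surjective (n : ℕ) : Function.Surjective (Torus.mk : (Fin n → ℝ) → Torus n) :=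
  (isOpenQuotientMap_torusMk n).surjective

/-- The homomorphism of tori defined by an integral matrix. -/
def torusHom {n d : ℕ} (a : Matrix (Fin d) (Fin n) ℤ) : Torus n →+ Torus d where
  toFun x j := ∑ i, a j i • x i
  map_zero' := by
    ext j
    simp
  map_add' x y := by
    ext j
    simp [Finset.sum_add_distrib]

theorem torusHom_mk {n d : ℕ} (a : Matrix (Fin d) (Fin n) ℤ) (t : Fin n → ℝ) :
    torusHom a (Torus.mk t) = Torus.mk (fun j => ∑ i, (a j i : ℝ) * t i) := by
  ext j
  have h : ((∑ i, (a j i : ℝ) * t i : ℝ) : UnitAddCircle)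
      = ∑ i, (((a j i : ℝ) * t i : ℝ) : UnitAddCircle) :=
    map_sum (QuotientAddGroup.mk' (AddSubgroup.zmultiples (1 : ℝ)))
      (fun i => (a j i : ℝ) * t i) Finset.univ
  refine Eq.trans ?_ h.symm
  change ∑ i, a j i • ((t i : ℝ) : UnitAddCircle) = _
  refine Finset.sum_congr rfl fun i _ => ?_
  rw [← zsmul_eq_mul]
  rfl

theorem isLieHom_torusHom {n d : ℕ} (a : Matrix (Fin d) (Fin n) ℤ) : IsLieHom (torusHom a) := by
  refine ⟨fun j => ?_⟩
  have h : (fun t : Fin n → ℝ => (torusHom a (Torus.mk t) j).toCircle)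
      = fun t => Circle.exp (2 * Real.pi / 1 * ∑ i, (a j i : ℝ) * t i) := by
    funext t
    rw [torusHom_mk]
    exact AddCircle.toCircle_apply_mk _
  rw [h]
  refine contMDiff_circleExp.comp (ContDiff.contMDiff ?_)
  fun_prop

theorem torusHom_comp {n d e : ℕ} (b : Matrix (Fin e) (Fin d) ℤ) (a : Matrix (Fin d) (Fin n) ℤ)
    (x : Torus n) : torusHom b (torusHom a x) = torusHom (b * a) x := by
  ext k
  simp only [torusHom, AddMonoidHom.coe_mk, ZeroHom.coe_mk, Matrix.mul_apply, Finset.smul_sum,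
    Finset.sum_smul, mul_smul]
  rw [Finset.sum_comm]

/-- Multiplying a by adj(aᵀa)aᵀ gives the scalar D = det(aᵀa), so D annihilates the kernel.
Injectivity over ℝ makes D nonzero, and a torus has finitely many points killed by a nonzero
integer. -/
theorem finite_ker_torusHom {n d : ℕ} (a : Matrix (Fin d) (Fin n) ℤ)
    (ha : Function.Injective (fun t : Fin n → ℝ => fun j => ∑ i, (a j i : ℝ) * t i)) :
    ((torusHom a).ker : Set (Torus n)).Finite := by
  set D := (a.transpose * a).det with hD
  have hD0 : D ≠ 0 := by
    intro h0
    have h1 : ((a.map (Int.cast : ℤ → ℝ)).transpose * a.map (Int.cast : ℤ → ℝ)).det = 0 := by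
      have h2 : (a.map (Int.cast : ℤ → ℝ)).transpose * a.map (Int.cast : ℤ → ℝ)
          = (a.transpose * a).map (Int.castRingHom ℝ) := by
        rw [Matrix.map_mul]
        rfl
      rw [h2, ← RingHom.mapMatrix_apply, ← RingHom.map_det, ← hD, h0, map_zero]
    obtain ⟨v, hv, hv0⟩ := Matrix.exists_mulVec_eq_zero_iff.2 h1
    -- |av|² = v · aᵀav = 0.
    have h3 : a.map (Int.cast : ℤ → ℝ) *ᵥ v = 0 := by
      rw [← dotProduct_self_eq_zero, ← Matrix.vecMul_transpose, ← Matrix.dotProduct_mulVec,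
        Matrix.mulVec_transpose, ← Matrix.mulVec_transpose, Matrix.vecMul_transpose,
        Matrix.mulVec_mulVec, hv0, dotProduct_zero]
    refine hv (ha ?_)
    funext j
    simpa [Matrix.mulVec, dotProduct] using congrFun h3 j
  refine (finite_torus_nsmul_eq_zero n (Int.natAbs_pos.2 hD0)).subset ?_
  intro x hx
  have hx' : torusHom a x = 0 := hx
  have h1 : torusHom ((a.transpose * a).adjugate * (a.transpose * a)) x = 0 := by
    rw [← torusHom_comp, ← torusHom_comp, hx', map_zero, map_zero]
  rw [Matrix.adjugate_mul, ← hD] at h1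
  have h2 : D • x = 0 := by
    rw [← h1]
    ext j
    rw [Pi.smul_apply]
    simp only [torusHom, AddMonoidHom.coe_mk, ZeroHom.coe_mk]
    rw [Finset.sum_eq_single j]
    · simp
    · intro i _ hi
      simp [Matrix.one_apply_ne hi.symm]
    · simp
  rw [Set.mem_ofPred_eq, ← natCast_zsmul]
  rcases Int.natAbs_eq D with h | h
  · rw [← h, h2]
  · rw [← neg_eq_zero, ← neg_zsmul, ← h, h2]

end Torus

/-! ### Holomorphic maps in charts: the identity principle and extension from dense sets -/

section Holomorphic

variable {n d : ℕ} {N : Type*} [TopologicalSpace N] [ChartedSpace (CModel n) N]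
  [IsManifold 𝓘(ℂ, CModel n) ω N]
  {N' : Type*} [TopologicalSpace N'] [ChartedSpace (CModel d) N'] [IsManifold 𝓘(ℂ, CModel d) ω N']
  {m : N → N'}

theorem chartAt_comp_symm_differentiableAt (p q : N)
    (hp : p ∈ (chartAt (CModel n) q).source) :
    DifferentiableAt ℂ (chartAt (CModel n) q ∘ (chartAt (CModel n) p).symm)
      (chartAt (CModel n) p p) := by
  have h := (contDiffGroupoid ω 𝓘(ℂ, CModel n)).compatible (chart_mem_atlas (CModel n) p)
    (chart_mem_atlas (CModel n) q)
  rw [contDiffGroupoid, mem_groupoid_of_pregroupoid] at h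
  have h1 : ContDiffOn ℂ ω (chartAt (CModel n) q ∘ (chartAt (CModel n) p).symm)
      ((chartAt (CModel n) p).symm.trans (chartAt (CModel n) q)).source := by
    simpa [contDiffPregroupoid] using h.1
  refine (h1.differentiableOn (by simp)).differentiableAt
    (((chartAt (CModel n) p).symm.trans (chartAt (CModel n) q)).open_source.mem_nhds ?_)
  simp [hp]

/-- The differentials of the charts of a complex manifold are complex linear. -/
theorem mvfderiv_chartAt_complexJ {p q : N} (hp : p ∈ (chartAt (CModel n) q).source)
    (v : TangentSpace 𝓘(ℝ, CModel n) p) :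
    mvfderiv 𝓘(ℝ, CModel n) (chartAt (CModel n) q) p (complexJ p v)
      = Complex.I • mvfderiv 𝓘(ℝ, CModel n) (chartAt (CModel n) q) p v := by
  have h0 : mfderiv 𝓘(ℝ, CModel n) 𝓘(ℝ, CModel n) (chartAt (CModel n) q) p
      = tangentCoordChange 𝓘(ℝ, CModel n) p q p := mfderiv_chartAt_eq_tangentCoordChange hp
  have h1 : tangentCoordChange 𝓘(ℝ, CModel n) p q p
      = fderiv ℝ (chartAt (CModel n) q ∘ (chartAt (CModel n) p).symm)
        (chartAt (CModel n) p p) := by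
    rw [tangentCoordChange_def]
    simp [fderivWithin_univ]
  have h2 := (chartAt_comp_symm_differentiableAt p q hp).fderiv_restrictScalars ℝ
  have h3 : ∀ w : CModel n, mvfderiv 𝓘(ℝ, CModel n) (chartAt (CModel n) q) p w
      = fderiv ℂ (chartAt (CModel n) q ∘ (chartAt (CModel n) p).symm)
        (chartAt (CModel n) p p) w := fun w =>
    congrArg (fun T : CModel n →L[ℝ] CModel n => T w) (h0.trans (h1.trans h2))
  refine (h3 _).trans (Eq.trans ?_ (congrArg (Complex.I • ·) (h3 v)).symm)
  exact map_smul (fderiv ℂ (chartAt (CModel n) q ∘ (chartAt (CModel n) p).symm)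
        (chartAt (CModel n) p p)) Complex.I (show CModel n from v)

theorem isInvertible_mvfderiv_chartAt {p q : N} (hp : p ∈ (chartAt (CModel n) q).source) :
    (mvfderiv 𝓘(ℝ, CModel n) (chartAt (CModel n) q) p).IsInvertible :=
  ⟨(mdifferentiable_chart (I := 𝓘(ℝ, CModel n)) q).mfderiv hp, rfl⟩

/-- A map of complex manifolds, expressed in the charts around `q` and `q'`. -/
def chartRep (n d : ℕ) {N N' : Type*} [TopologicalSpace N] [ChartedSpace (CModel n) N]
    [TopologicalSpace N'] [ChartedSpace (CModel d) N'] (m : N → N') (q : N) (q' : N') :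
    CModel n → CModel d :=
  chartAt (CModel d) q' ∘ m ∘ (chartAt (CModel n) q).symm

theorem contDiffAt_chartRep (hm : ContMDiff 𝓘(ℝ, CModel n) 𝓘(ℝ, CModel d) ∞ m) {q : N} {q' : N'}
    {y : CModel n} (hy : y ∈ (chartAt (CModel n) q).target)
    (hy' : m ((chartAt (CModel n) q).symm y) ∈ (chartAt (CModel d) q').source) :
    ContDiffAt ℝ ∞ (chartRep n d m q q') y := by
  have h1 : ContMDiffAt 𝓘(ℝ, CModel n) 𝓘(ℝ, CModel n) ∞ (chartAt (CModel n) q).symm y :=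
    (contMDiffOn_chart_symm (I := 𝓘(ℝ, CModel n)) (x := q)).contMDiffAt
      ((chartAt (CModel n) q).open_target.mem_nhds hy)
  have h2 : ContMDiffAt 𝓘(ℝ, CModel d) 𝓘(ℝ, CModel d) ∞ (chartAt (CModel d) q')
      (m ((chartAt (CModel n) q).symm y)) :=
    (contMDiffOn_chart (I := 𝓘(ℝ, CModel d)) (x := q')).contMDiffAt
      ((chartAt (CModel d) q').open_source.mem_nhds hy')
  exact (h2.comp y ((hm _).comp y h1)).contDiffAt

theorem fderiv_chartRep (hm : ContMDiff 𝓘(ℝ, CModel n) 𝓘(ℝ, CModel d) ∞ m) {p q : N} {q' : N'}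
    (hp : p ∈ (chartAt (CModel n) q).source) (hp' : m p ∈ (chartAt (CModel d) q').source)
    (v : TangentSpace 𝓘(ℝ, CModel n) p) :
    fderiv ℝ (chartRep n d m q q') (chartAt (CModel n) q p)
        (mvfderiv 𝓘(ℝ, CModel n) (chartAt (CModel n) q) p v)
      = mvfderiv 𝓘(ℝ, CModel d) (chartAt (CModel d) q') (m p)
        (mfderiv 𝓘(ℝ, CModel n) 𝓘(ℝ, CModel d) m p v) := by
  have hinv := (chartAt (CModel n) q).left_inv hp
  have hD : DifferentiableAt ℝ (chartRep n d m q q') (chartAt (CModel n) q p) := by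
    refine (contDiffAt_chartRep hm ((chartAt (CModel n) q).map_source hp) ?_).differentiableAt
      (by simp)
    rwa [hinv]
  have hφ : MDifferentiableAt 𝓘(ℝ, CModel n) 𝓘(ℝ, CModel n) (chartAt (CModel n) q) p :=
    (mdifferentiable_chart (I := 𝓘(ℝ, CModel n)) q).mdifferentiableAt hp
  have hψ : MDifferentiableAt 𝓘(ℝ, CModel d) 𝓘(ℝ, CModel d) (chartAt (CModel d) q') (m p) :=
    (mdifferentiable_chart (I := 𝓘(ℝ, CModel d)) q').mdifferentiableAt hp'
  have h1 := hD.hasFDerivAt.hasMFDerivAt.comp p hφ.hasMFDerivAt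
  have h2 := hψ.hasMFDerivAt.comp p (hm.mdifferentiable (by simp) p).hasMFDerivAt
  have h3 : chartRep n d m q q' ∘ chartAt (CModel n) q =ᶠ[𝓝 p] chartAt (CModel d) q' ∘ m := by
    filter_upwards [(chartAt (CModel n) q).open_source.mem_nhds hp] with x hx
    simp [chartRep, hx]
  have h4 := hasMFDerivAt_unique (h2.congr_of_eventuallyEq h3) h1
  exact (congrArg (fun T => T v) h4).symm

/-- The charts have invertible complex linear differentials. Charts centred at points other than p
are allowed, so that one fixed pair of charts can serve a whole neighbourhood. -/
theorem commutes_complexJ_iff (hm : ContMDiff 𝓘(ℝ, CModel n) 𝓘(ℝ, CModel d) ∞ m) {p q : N}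
    {q' : N'} (hp : p ∈ (chartAt (CModel n) q).source)
    (hp' : m p ∈ (chartAt (CModel d) q').source) :
    (∀ v, mfderiv 𝓘(ℝ, CModel n) 𝓘(ℝ, CModel d) m p (complexJ p v)
      = complexJ (m p) (mfderiv 𝓘(ℝ, CModel n) 𝓘(ℝ, CModel d) m p v)) ↔
    ∀ w, fderiv ℝ (chartRep n d m q q') (chartAt (CModel n) q p) (Complex.I • w)
      = Complex.I • fderiv ℝ (chartRep n d m q q') (chartAt (CModel n) q p) w := by
  have hφ := isInvertible_mvfderiv_chartAt (n := n) hp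
  have hψ := isInvertible_mvfderiv_chartAt (n := d) hp'
  constructor
  · intro h w
    obtain ⟨v, rfl⟩ := hφ.bijective.surjective w
    rw [← mvfderiv_chartAt_complexJ hp, fderiv_chartRep hm hp hp', h v,
      mvfderiv_chartAt_complexJ hp', fderiv_chartRep hm hp hp']
  · intro h v
    apply hψ.bijective.injective
    rw [← fderiv_chartRep hm hp hp', mvfderiv_chartAt_complexJ hp, h,
      mvfderiv_chartAt_complexJ hp', fderiv_chartRep hm hp hp']

/-- Cauchy–Riemann: a real derivative that commutes with i is complex linear. -/
theorem IsHolomorphic.differentiableAt_chartRep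
    (hm : ContMDiff 𝓘(ℝ, CModel n) 𝓘(ℝ, CModel d) ∞ m) (hol : IsHolomorphic n d m) {q : N}
    {q' : N'} {y : CModel n} (hy : y ∈ (chartAt (CModel n) q).target)
    (hy' : m ((chartAt (CModel n) q).symm y) ∈ (chartAt (CModel d) q').source) :
    DifferentiableAt ℂ (chartRep n d m q q') y := by
  have h := (commutes_complexJ_iff hm ((chartAt (CModel n) q).map_target hy) hy').1 (hol _)
  rw [(chartAt (CModel n) q).right_inv hy] at h
  rw [differentiableAt_iff_restrictScalars ℝ
    ((contDiffAt_chartRep hm hy hy').differentiableAt (by simp))]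
  set D := fderiv ℝ (chartRep n d m q q') y
  refine ⟨{ toFun := D, map_add' := D.map_add, cont := D.continuous, map_smul' := fun c w => ?_ },
    rfl⟩
  have hc : ∀ x : CModel n, c • x = c.re • x + c.im • (Complex.I • x) := fun x => by
    conv_lhs => rw [← Complex.re_add_im c]
    rw [add_smul, mul_smul]
    rfl
  have hc' : ∀ x : CModel d, c • x = c.re • x + c.im • (Complex.I • x) := fun x => by
    conv_lhs => rw [← Complex.re_add_im c]
    rw [add_smul, mul_smul]
    rfl
  rw [hc w, D.map_add, map_smul, map_smul, h w]
  exact (hc' _).symm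

/-- The identity principle on a ball. -/
theorem eqOn_zero_ball {c y₀ : CModel n} {r : ℝ} {g : CModel n → CModel d}
    (hg : ∀ y ∈ Metric.ball c r, DifferentiableAt ℂ g y) (hy₀ : y₀ ∈ Metric.ball c r)
    (h0 : g =ᶠ[𝓝 y₀] 0) : Set.EqOn g 0 (Metric.ball c r) := by
  intro y hy
  -- Restrict to the complex line from y₀ (z = 0) to y (z = 1). Its part in the ball is convex, so
  -- the identity theorem in one variable applies.
  let ℓ : ℂ → CModel n := fun z => y₀ + z • (y - y₀)
  have hℓ : Differentiable ℂ ℓ := by fun_prop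
  have hℓ0 : ℓ 0 = y₀ := by simp [ℓ]
  have hU : IsOpen (ℓ ⁻¹' Metric.ball c r) := Metric.isOpen_ball.preimage hℓ.continuous
  have hconv : Convex ℝ (ℓ ⁻¹' Metric.ball c r) := by
    intro z hz w hw a b ha hb hab
    have h1 : ℓ (a • z + b • w) = a • ℓ z + b • ℓ w := by
      have h2 : y₀ = a • y₀ + b • y₀ := by rw [← add_smul, hab, one_smul]
      simp only [ℓ, smul_add, add_smul, smul_assoc]
      nth_rewrite 1 [h2]
      abel
    rw [Set.mem_preimage, h1]
    exact convex_ball c r hz hw ha hb hab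
  have han : AnalyticOnNhd ℂ (g ∘ ℓ) (ℓ ⁻¹' Metric.ball c r) :=
    DifferentiableOn.analyticOnNhd
      (fun z hz => ((hg _ hz).comp z (hℓ z)).differentiableWithinAt) hU
  have hz : (g ∘ ℓ) =ᶠ[𝓝 0] 0 := by
    have h1 : Filter.Tendsto ℓ (𝓝 0) (𝓝 y₀) := by
      have := hℓ.continuous.tendsto 0
      rwa [hℓ0] at this
    exact h1.eventually h0
  have h := han.eqOn_zero_of_preconnected_of_eventuallyEq_zero hconv.isPreconnected
    (by rw [Set.mem_preimage, hℓ0]; exact hy₀) hz (x := 1) (by simp [ℓ, hy])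
  simpa [ℓ] using h

/-- The identity principle: a holomorphic self-map of a connected complex manifold which is the
identity on a nonempty open set is the identity. -/
theorem IsHolomorphic.eq_id [T2Space N] [PreconnectedSpace N] {m : N → N}
    (hm : ContMDiff 𝓘(ℝ, CModel n) 𝓘(ℝ, CModel n) ∞ m) (hol : IsHolomorphic n n m) {p₀ : N}
    (h0 : ∀ᶠ p in 𝓝 p₀, m p = p) (p : N) : m p = p := by
  -- The points near which m is the identity form an open set; the work is to show that it is
  -- closed.
  have hop : IsOpen {p : N | ∀ᶠ q in 𝓝 p, m q = q} := isOpen_setOfPred_eventually_nhds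
  have hcl : IsClosed {p : N | ∀ᶠ q in 𝓝 p, m q = q} := by
    rw [isClosed_iff_clusterPt]
    intro p hp
    -- A limit point is fixed by continuity, so one chart serves as source and target near it. A
    -- nearby point of the set then starts the identity principle on a ball.
    have hfix : m p = p := by
      have hc : IsClosed {q : N | m q = q} := isClosed_eq hm.continuous continuous_id
      have hsub : {p : N | ∀ᶠ q in 𝓝 p, m q = q} ⊆ {q : N | m q = q} := fun q hq => hq.self_of_nhds
      exact closure_minimal hsub hc (mem_closure_iff_clusterPt.2 hp)
    set φ := chartAt (CModel n) p
    have hps : p ∈ φ.source := mem_chart_source _ p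
    have hV : φ.target ∩ φ.symm ⁻¹' (m ⁻¹' φ.source) ∈ 𝓝 (φ p) := by
      refine Filter.inter_mem (φ.open_target.mem_nhds (φ.map_source hps)) ?_
      refine (φ.continuousAt_symm (φ.map_source hps)).preimage_mem_nhds ?_
      rw [φ.left_inv hps]
      refine hm.continuous.continuousAt.preimage_mem_nhds ?_
      rw [hfix]
      exact φ.open_source.mem_nhds hps
    obtain ⟨r, hr, hB⟩ := Metric.mem_nhds_iff.1 hV
    have hW : φ.source ∩ φ ⁻¹' Metric.ball (φ p) r ∈ 𝓝 p :=
      Filter.inter_mem (φ.open_source.mem_nhds hps)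
        ((φ.continuousAt hps).preimage_mem_nhds (Metric.ball_mem_nhds _ hr))
    obtain ⟨q, hqW, hq⟩ := mem_closure_iff_nhds.1 (mem_closure_iff_clusterPt.2 hp) _ hW
    have hd : ∀ y ∈ Metric.ball (φ p) r, DifferentiableAt ℂ (fun y => chartRep n n m p p y - y) y :=
      fun y hy => (IsHolomorphic.differentiableAt_chartRep hm hol (hB hy).1 (hB hy).2).sub
        differentiableAt_id
    have hz : (fun y => chartRep n n m p p y - y) =ᶠ[𝓝 (φ q)] 0 := by
      have h1 : ∀ᶠ y in 𝓝 (φ q), m (φ.symm y) = φ.symm y := by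
        have h2 := φ.continuousAt_symm (φ.map_source hqW.1)
        rw [ContinuousAt, φ.left_inv hqW.1] at h2
        exact h2.eventually hq
      filter_upwards [h1, φ.open_target.mem_nhds (φ.map_source hqW.1)] with y hy hyt
      change φ (m (φ.symm y)) - y = 0
      rw [hy, φ.right_inv hyt, sub_self]
    have hzero := eqOn_zero_ball hd hqW.2 hz
    filter_upwards [hW] with x hx
    have h1 : φ (m (φ.symm (φ x))) - φ x = 0 := hzero hx.2
    have h2 := (hB hx.2).2
    rw [Set.mem_preimage, Set.mem_preimage, φ.left_inv hx.1] at h2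
    rw [φ.left_inv hx.1, sub_eq_zero] at h1
    exact φ.injOn h2 hx.1 h1
  have huniv := IsClopen.eq_univ ⟨hcl, hop⟩ ⟨p₀, h0⟩
  have : p ∈ {p : N | ∀ᶠ q in 𝓝 p, m q = q} := huniv ▸ Set.mem_univ p
  exact this.self_of_nhds

/-- Holomorphy extends from a dense set. -/
theorem isHolomorphic_of_dense (hm : ContMDiff 𝓘(ℝ, CModel n) 𝓘(ℝ, CModel d) ∞ m) {s : Set N}
    (hs : Dense s) (h : ∀ p ∈ s, ∀ v, mfderiv 𝓘(ℝ, CModel n) 𝓘(ℝ, CModel d) m p (complexJ p v)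
      = complexJ (m p) (mfderiv 𝓘(ℝ, CModel n) 𝓘(ℝ, CModel d) m p v)) :
    IsHolomorphic n d m := by
  intro p
  set φ := chartAt (CModel n) p
  set ψ := chartAt (CModel d) (m p)
  have hps : p ∈ φ.source := mem_chart_source _ p
  have hps' : m p ∈ ψ.source := mem_chart_source _ (m p)
  rw [commutes_complexJ_iff hm hps hps']
  intro w
  have hU : φ.source ∩ m ⁻¹' ψ.source ∈ 𝓝 p := Filter.inter_mem (φ.open_source.mem_nhds hps)
    (hm.continuous.continuousAt.preimage_mem_nhds (ψ.open_source.mem_nhds hps'))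
  -- With both charts fixed, the derivative takes values in one space and depends continuously on q,
  -- so commuting with i passes to the limit.
  have hD : ContinuousAt (fun q => fderiv ℝ (chartRep n d m p (m p)) (φ q)) p := by
    have h1 : ContDiffAt ℝ ∞ (chartRep n d m p (m p)) (φ p) :=
      contDiffAt_chartRep hm (φ.map_source hps) (by rwa [φ.left_inv hps])
    have h2 := (h1.fderiv_right (m := 0) (by simp)).continuousAt
    exact ContinuousAt.comp (f := φ) h2 (φ.continuousAt hps)
  have hfreq : ∃ᶠ q in 𝓝 p, fderiv ℝ (chartRep n d m p (m p)) (φ q) (Complex.I • w)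
      = Complex.I • fderiv ℝ (chartRep n d m p (m p)) (φ q) w := by
    have h1 : ∃ᶠ q in 𝓝 p, q ∈ s := mem_closure_iff_frequently.1 (hs p)
    refine (h1.and_eventually hU).mono ?_
    rintro q ⟨hqs, hq, hq'⟩
    exact (commutes_complexJ_iff hm hq hq').1 (h q hqs) w
  have hc1 : Filter.Tendsto (fun q => fderiv ℝ (chartRep n d m p (m p)) (φ q) (Complex.I • w)
      - Complex.I • fderiv ℝ (chartRep n d m p (m p)) (φ q) w) (𝓝 p)
      (𝓝 (fderiv ℝ (chartRep n d m p (m p)) (φ p) (Complex.I • w)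
      - Complex.I • fderiv ℝ (chartRep n d m p (m p)) (φ p) w)) :=
    (hD.clm_apply continuousAt_const).sub
      (Filter.Tendsto.const_smul (hD.clm_apply continuousAt_const) Complex.I)
  have hcl := isClosed_singleton (x := (0 : CModel d)) |>.mem_of_frequently_of_tendsto
    (hfreq.mono fun q hq => by rw [Set.mem_singleton_iff, sub_eq_zero]; exact hq) hc1
  exact sub_eq_zero.1 hcl

/-- Isometry extends from a dense set. -/
theorem isIsometric_of_dense (G : Kahler n N) (G' : Kahler d N')
    (hm : ContMDiff 𝓘(ℝ, CModel n) 𝓘(ℝ, CModel d) ∞ m) {s : Set N} (hs : Dense s)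
    (h : ∀ p ∈ s, ∀ v w : TangentSpace 𝓘(ℝ, CModel n) p,
      G'.metric.inner (m p) (mfderiv 𝓘(ℝ, CModel n) 𝓘(ℝ, CModel d) m p v)
        (mfderiv 𝓘(ℝ, CModel n) 𝓘(ℝ, CModel d) m p w) = G.metric.inner p v w) :
    IsIsometric G G' m := by
  intro p v w
  -- Extending v and w to fields continuous at p turns both sides of the isometry equation into
  -- functions of the base point that can be compared in the limit.
  let V := FiberBundle.extend (CModel n) (E := (TangentSpace 𝓘(ℝ, CModel n) : N → Type _)) v
  let W := FiberBundle.extend (CModel n) (E := (TangentSpace 𝓘(ℝ, CModel n) : N → Type _)) w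
  have hV : ContinuousAt (fun q => (⟨q, V q⟩ : TangentBundle 𝓘(ℝ, CModel n) N)) p :=
    (FiberBundle.mdifferentiableAt_extend 𝓘(ℝ, CModel n) (CModel n) v).continuousAt
  have hW : ContinuousAt (fun q => (⟨q, W q⟩ : TangentBundle 𝓘(ℝ, CModel n) N)) p :=
    (FiberBundle.mdifferentiableAt_extend 𝓘(ℝ, CModel n) (CModel n) w).continuousAt
  have hT : Continuous (tangentMap 𝓘(ℝ, CModel n) 𝓘(ℝ, CModel d) m) :=
    hm.continuous_tangentMap (by simp)
  have hc : ContinuousAt (fun q => G.metric.inner q (V q) (W q)) p := by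
    have h1 := ContinuousAt.clm_bundle_apply₂ (b := id) (F₁ := CModel n) (F₂ := CModel n)
      (F₃ := ℝ) (E₃ := Bundle.Trivial N ℝ)
      (ψ := fun q => G.metric.inner q) G.metric.contMDiff.continuous.continuousAt hV hW
    simp only [FiberBundle.continuousAt_totalSpace] at h1
    exact h1.2
  have hc' : ContinuousAt (fun q => G'.metric.inner (m q)
      (mfderiv 𝓘(ℝ, CModel n) 𝓘(ℝ, CModel d) m q (V q))
      (mfderiv 𝓘(ℝ, CModel n) 𝓘(ℝ, CModel d) m q (W q))) p := by
    have h1 := ContinuousAt.clm_bundle_apply₂ (b := m) (F₁ := CModel d) (F₂ := CModel d)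
      (F₃ := ℝ) (E₃ := Bundle.Trivial N' ℝ)
      (ψ := fun q => G'.metric.inner (m q))
      (G'.metric.contMDiff.continuous.comp hm.continuous).continuousAt
      (hT.continuousAt.comp hV) (hT.continuousAt.comp hW)
    simp only [FiberBundle.continuousAt_totalSpace] at h1
    exact h1.2
  have hfreq := mem_closure_iff_frequently.1 (hs p)
  have hcl := (isClosed_singleton (x := (0 : ℝ))).mem_of_frequently_of_tendsto
    (hfreq.mono fun q hq => by
      exact sub_eq_zero.2 (h q hq (V q) (W q))) (hc'.sub hc)
  have hVp : V p = v := FiberBundle.extend_apply_self _ v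
  have hWp : W p = w := FiberBundle.extend_apply_self _ w
  have h2 : G'.metric.inner (m p) (mfderiv 𝓘(ℝ, CModel n) 𝓘(ℝ, CModel d) m p (V p))
      (mfderiv 𝓘(ℝ, CModel n) 𝓘(ℝ, CModel d) m p (W p)) = G.metric.inner p (V p) (W p) :=
    sub_eq_zero.1 hcl
  rwa [hVp, hWp] at h2

end Holomorphic

/-! ### Density of the free points -/

section Free

variable {n : ℕ} {N : Type*} [TopologicalSpace N] [ChartedSpace (CModel n) N]
  [IsManifold 𝓘(ℂ, CModel n) ω N] {G : Kahler n N} (Φ : TorusAction G)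

theorem TorusAction.contMDiff_act (a : Torus n) :
    ContMDiff 𝓘(ℝ, CModel n) 𝓘(ℝ, CModel n) ∞ (Φ.act a) := by
  obtain ⟨t, rfl⟩ := torusMk_surjective n a
  exact Φ.smooth.comp (contMDiff_const.prodMk contMDiff_id)

theorem TorusAction.continuous_act_left (p : N) : Continuous fun a => Φ.act a p :=
  (isOpenQuotientMap_torusMk n).isQuotientMap.continuous_iff.2
    (Φ.smooth.continuous.comp (continuous_id.prodMk continuous_const))

/-- The stabilizer of a point under a torus action. -/
def TorusAction.stabilizer (p : N) : AddSubgroup (Torus n) where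
  carrier := {a | Φ.act a p = p}
  zero_mem' := Φ.act_zero p
  add_mem' {a b} ha hb := by
    have ha' : Φ.act a p = p := ha
    have hb' : Φ.act b p = p := hb
    exact (Φ.act_add a b p).trans (by rw [hb', ha'])
  neg_mem' {a} ha := by
    have ha' : Φ.act a p = p := ha
    have h := Φ.act_add (-a) a p
    rw [neg_add_cancel, Φ.act_zero, ha'] at h
    exact h.symm

theorem TorusAction.isClosed_fixed [T2Space N] (a : Torus n) : IsClosed {p | Φ.act a p = p} :=
  isClosed_eq (Φ.contMDiff_act a).continuous continuous_id

/-- If a fixed an open set pointwise, the identity principle would make it act as the identity, and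
effectiveness would give a = 0. -/
theorem TorusAction.dense_compl_fixed [T2Space N] [PreconnectedSpace N] {a : Torus n}
    (ha : a ≠ 0) : Dense {p | Φ.act a p = p}ᶜ := by
  rw [← interior_eq_empty_iff_dense_compl, Set.eq_empty_iff_forall_notMem]
  intro p hp
  exact ha (Φ.effective a
    (IsHolomorphic.eq_id (Φ.contMDiff_act a) (Φ.holomorphic a) (mem_interior_iff_mem_nhds.1 hp)))

/-- The free points of a torus action on a connected Kähler manifold are dense. -/
theorem TorusAction.dense_free [T2Space N] [PreconnectedSpace N] : Dense Φ.free := by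
  have : LocallyCompactSpace N := ChartedSpace.locallyCompactSpace (CModel n) N
  -- Baire's theorem needs a countable family, hence the restriction to torsion elements. They
  -- suffice because a nontrivial closed stabilizer contains one.
  have hd : Dense (⋂ a ∈ {a : Torus n | IsOfFinAddOrder a ∧ a ≠ 0}, {p | Φ.act a p = p}ᶜ) :=
    dense_biInter_of_isOpen (fun a _ => (Φ.isClosed_fixed a).isOpen_compl)
      ((countable_torus_torsion n).mono fun a ha => ha.1) fun a ha => Φ.dense_compl_fixed ha.2
  refine hd.mono fun p hp => ?_
  by_contra hfree
  have hne : Φ.stabilizer p ≠ ⊥ := fun h => hfree fun a ha => by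
    have : a ∈ Φ.stabilizer p := ha
    rwa [h, AddSubgroup.mem_bot] at this
  have hcl : IsClosed ((Φ.stabilizer p : AddSubgroup (Torus n)) : Set (Torus n)) :=
    isClosed_eq (Φ.continuous_act_left p) continuous_const
  obtain ⟨a, ha, ha0, hfin⟩ := exists_torsion_of_closed n (Φ.stabilizer p) hcl hne
  exact Set.mem_iInter₂.1 hp a ⟨hfin, ha0⟩ ha

end Free

/-! ### Transfer of holomorphy and isometry between f, f_* and m -/

section Lift

variable {n d : ℕ}
  {M : Type*} [TopologicalSpace M] [ChartedSpace (RModel n) M] [IsManifold (𝓡 n) ∞ M]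
  {M' : Type*} [TopologicalSpace M'] [ChartedSpace (RModel d) M'] [IsManifold (𝓡 d) ∞ M']
  {N : Type*} [TopologicalSpace N] [ChartedSpace (CModel n) N] [IsManifold 𝓘(ℂ, CModel n) ω N]
  {N' : Type*} [TopologicalSpace N'] [ChartedSpace (CModel d) N']
  [IsManifold 𝓘(ℂ, CModel d) ω N']
  {S : DuallyFlat n M} {S' : DuallyFlat d M'} {G : Kahler n N} {G' : Kahler d N'}
  {Φ : TorusAction G} {Φ' : TorusAction G'} {f : M → M'} {m : N → N'}

/-- The compatible covering map of a toric parametrization. -/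
def ToricParametrization.cover (P : ToricParametrization S Φ) (u : TangentBundle (𝓡 n) M) : N :=
  P.F (quotientMap P.X u)

theorem ToricParametrization.cover_mem_free (P : ToricParametrization S Φ)
    (u : TangentBundle (𝓡 n) M) : P.cover u ∈ Φ.free := (P.F _).2

theorem ToricParametrization.exists_cover_eq (P : ToricParametrization S Φ) {p : N}
    (hp : p ∈ Φ.free) : ∃ u, P.cover u = p := by
  obtain ⟨x, hx⟩ := P.F.surjective ⟨p, hp⟩
  obtain ⟨u, rfl⟩ := Quotient.exists_rep x
  exact ⟨u, congrArg Subtype.val hx⟩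

theorem ToricParametrization.mdifferentiableAt_cover (P : ToricParametrization S Φ)
    (u : TangentBundle (𝓡 n) M) :
    MDifferentiableAt (𝓡 n).tangent 𝓘(ℝ, CModel n) P.cover u :=
  (P.isLocalDiffeomorph u).mdifferentiableAt (by simp)

theorem ToricParametrization.bijective_mfderiv_cover (P : ToricParametrization S Φ)
    (u : TangentBundle (𝓡 n) M) :
    Function.Bijective (mfderiv (𝓡 n).tangent 𝓘(ℝ, CModel n) P.cover u) :=
  ((P.isLocalDiffeomorph u).mfderivToContinuousLinearEquiv (by simp)).bijective

/-- The differential of the covering map is surjective and intertwines the complex structures, so it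
can be cancelled on the right. -/
theorem ToricParametrization.commutes_comp_cover_iff (P : ToricParametrization S Φ)
    (hm : ContMDiff 𝓘(ℝ, CModel n) 𝓘(ℝ, CModel d) ∞ m) (u : TangentBundle (𝓡 n) M) :
    (∀ A, mfderiv (𝓡 n).tangent 𝓘(ℝ, CModel d) (m ∘ P.cover) u (tangentJ S.conn u A)
      = complexJ _ (mfderiv (𝓡 n).tangent 𝓘(ℝ, CModel d) (m ∘ P.cover) u A)) ↔
    ∀ v, mfderiv 𝓘(ℝ, CModel n) 𝓘(ℝ, CModel d) m (P.cover u) (complexJ (P.cover u) v)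
      = complexJ (m (P.cover u)) (mfderiv 𝓘(ℝ, CModel n) 𝓘(ℝ, CModel d) m (P.cover u) v) := by
  have hc : ∀ A, mfderiv (𝓡 n).tangent 𝓘(ℝ, CModel d) (m ∘ P.cover) u A
      = mfderiv 𝓘(ℝ, CModel n) 𝓘(ℝ, CModel d) m (P.cover u)
        (mfderiv (𝓡 n).tangent 𝓘(ℝ, CModel n) P.cover u A) := fun A =>
    mfderiv_comp_apply u (hm.mdifferentiable (by simp) _) (P.mdifferentiableAt_cover u) A
  have hJ := fun A => congrArg (mfderiv 𝓘(ℝ, CModel n) 𝓘(ℝ, CModel d) m (P.cover u))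
    (P.holomorphic u A)
  constructor
  · intro h v
    obtain ⟨A, rfl⟩ := (P.bijective_mfderiv_cover u).surjective v
    exact (hJ A).symm.trans ((hc _).symm.trans ((h A).trans (congrArg (complexJ _) (hc A))))
  · intro h A
    exact (hc _).trans ((hJ A).trans ((h _).trans (congrArg (complexJ _) (hc A)).symm))

theorem ToricParametrization.isometric_comp_cover_iff (P : ToricParametrization S Φ)
    (hm : ContMDiff 𝓘(ℝ, CModel n) 𝓘(ℝ, CModel d) ∞ m) (u : TangentBundle (𝓡 n) M) :
    (∀ A B, G'.metric.inner _ (mfderiv (𝓡 n).tangent 𝓘(ℝ, CModel d) (m ∘ P.cover) u A)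
      (mfderiv (𝓡 n).tangent 𝓘(ℝ, CModel d) (m ∘ P.cover) u B) = tangentMetric S u A B) ↔
    ∀ v w, G'.metric.inner (m (P.cover u))
        (mfderiv 𝓘(ℝ, CModel n) 𝓘(ℝ, CModel d) m (P.cover u) v)
        (mfderiv 𝓘(ℝ, CModel n) 𝓘(ℝ, CModel d) m (P.cover u) w)
      = G.metric.inner (P.cover u) v w := by
  have hc : ∀ A, mfderiv (𝓡 n).tangent 𝓘(ℝ, CModel d) (m ∘ P.cover) u A
      = mfderiv 𝓘(ℝ, CModel n) 𝓘(ℝ, CModel d) m (P.cover u)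
        (mfderiv (𝓡 n).tangent 𝓘(ℝ, CModel n) P.cover u A) := fun A =>
    mfderiv_comp_apply u (hm.mdifferentiable (by simp) _) (P.mdifferentiableAt_cover u) A
  have hc2 := fun A B => congrArg₂ (fun v w => G'.metric.inner (m (P.cover u)) v w) (hc A) (hc B)
  constructor
  · intro h v w
    obtain ⟨A, rfl⟩ := (P.bijective_mfderiv_cover u).surjective v
    obtain ⟨B, rfl⟩ := (P.bijective_mfderiv_cover u).surjective w
    exact (hc2 A B).symm.trans ((h A B).trans (P.isometric u A B).symm)
  · intro h A B
    exact (hc2 A B).trans ((h _ _).trans (P.isometric u A B))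

/-- Here injectivity of the differential of the covering map allows cancellation on the left. -/
theorem ToricParametrization.commutes_cover_comp_iff (P : ToricParametrization S' Φ')
    {T : TangentBundle (𝓡 n) M → TangentBundle (𝓡 d) M'} {u : TangentBundle (𝓡 n) M}
    (hT : MDifferentiableAt (𝓡 n).tangent (𝓡 d).tangent T u) :
    (∀ A, mfderiv (𝓡 n).tangent 𝓘(ℝ, CModel d) (P.cover ∘ T) u (tangentJ S.conn u A)
      = complexJ _ (mfderiv (𝓡 n).tangent 𝓘(ℝ, CModel d) (P.cover ∘ T) u A)) ↔
    ∀ A, mfderiv (𝓡 n).tangent (𝓡 d).tangent T u (tangentJ S.conn u A)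
      = tangentJ S'.conn (T u) (mfderiv (𝓡 n).tangent (𝓡 d).tangent T u A) := by
  have hc : ∀ A, mfderiv (𝓡 n).tangent 𝓘(ℝ, CModel d) (P.cover ∘ T) u A
      = mfderiv (𝓡 d).tangent 𝓘(ℝ, CModel d) P.cover (T u)
        (mfderiv (𝓡 n).tangent (𝓡 d).tangent T u A) := fun A =>
    mfderiv_comp_apply u (P.mdifferentiableAt_cover _) hT A
  constructor
  · intro h A
    apply (P.bijective_mfderiv_cover (T u)).injective
    exact (hc _).symm.trans ((h A).trans
      ((congrArg (complexJ _) (hc A)).trans (P.holomorphic _ _).symm))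
  · intro h A
    exact (hc _).trans ((congrArg _ (h A)).trans
      ((P.holomorphic _ _).trans (congrArg (complexJ _) (hc A)).symm))

theorem ToricParametrization.inner_cover_comp (P : ToricParametrization S' Φ')
    {T : TangentBundle (𝓡 n) M → TangentBundle (𝓡 d) M'} {u : TangentBundle (𝓡 n) M}
    (hT : MDifferentiableAt (𝓡 n).tangent (𝓡 d).tangent T u)
    (A B : TangentSpace (𝓡 n).tangent u) :
    G'.metric.inner _ (mfderiv (𝓡 n).tangent 𝓘(ℝ, CModel d) (P.cover ∘ T) u A)
      (mfderiv (𝓡 n).tangent 𝓘(ℝ, CModel d) (P.cover ∘ T) u B)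
    = tangentMetric S' (T u) (mfderiv (𝓡 n).tangent (𝓡 d).tangent T u A)
      (mfderiv (𝓡 n).tangent (𝓡 d).tangent T u B) := by
  have hc : ∀ A, mfderiv (𝓡 n).tangent 𝓘(ℝ, CModel d) (P.cover ∘ T) u A
      = mfderiv (𝓡 d).tangent 𝓘(ℝ, CModel d) P.cover (T u)
        (mfderiv (𝓡 n).tangent (𝓡 d).tangent T u A) := fun A =>
    mfderiv_comp_apply u (P.mdifferentiableAt_cover _) hT A
  have hc2 := congrArg₂ (fun v w => G'.metric.inner (P.cover (T u)) v w) (hc A) (hc B)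
  exact hc2.trans (P.isometric _ _ _)

theorem eq_of_projDeriv_connector {cov : Conn n M} {u : TangentBundle (𝓡 n) M}
    {A B : TangentSpace (𝓡 n).tangent u} (h1 : projDeriv u A = projDeriv u B)
    (h2 : connector cov u A = connector cov u B) : A = B := by
  have h3 : fibreCoord u A = fibreCoord u B := by
    rw [connector, connector, h1] at h2
    exact add_right_cancel h2
  rw [projDeriv_eq, projDeriv_eq] at h1
  exact Prod.ext h1 h3

/-- J sends (v,w) to (−w,v), and the π-component is always respected. Intertwining the connectors
therefore gives both components of the J-equation; conversely, the π-component of that equation is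
the connector condition up to sign. -/
theorem commutesWithConnectors_iff {cov : Conn n M} {cov' : Conn d M'}
    (hf : ContMDiff (𝓡 n) (𝓡 d) ∞ f) :
    CommutesWithConnectors cov cov' f ↔ ∀ u A,
      mfderiv (𝓡 n).tangent (𝓡 d).tangent (tangentMap (𝓡 n) (𝓡 d) f) u (tangentJ cov u A)
        = tangentJ cov' (tangentMap (𝓡 n) (𝓡 d) f u)
          (mfderiv (𝓡 n).tangent (𝓡 d).tangent (tangentMap (𝓡 n) (𝓡 d) f) u A) := by
  constructor
  · intro h u A
    apply eq_of_projDeriv_connector (cov := cov')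
    · refine (projDeriv_mfderiv_tangentMap hf u _).trans (Eq.trans ?_
        (projDeriv_tangentJ cov' _ _).symm)
      rw [projDeriv_tangentJ]
      exact (map_neg (mfderiv (𝓡 n) (𝓡 d) f u.proj) _).trans (congrArg Neg.neg (h u A).symm)
    · refine (h u _).trans (Eq.trans ?_ (connector_tangentJ cov' _ _).symm)
      rw [connector_tangentJ]
      exact (projDeriv_mfderiv_tangentMap hf u A).symm
  · intro h u A
    have h1 := congrArg (projDeriv _) (h u A)
    have h2 := (projDeriv_mfderiv_tangentMap hf u (tangentJ cov u A)).symm.trans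
      (h1.trans (projDeriv_tangentJ cov' _ _))
    rw [projDeriv_tangentJ] at h2
    exact (neg_injective ((map_neg (mfderiv (𝓡 n) (𝓡 d) f u.proj) _).symm.trans h2)).symm

theorem connector_ofCoord_zero (cov : Conn n M) (u : TangentBundle (𝓡 n) M)
    (v : TangentSpace (𝓡 n) u.proj) : connector cov u (ofCoord u 0 v) = v := by
  rw [connector, projDeriv_ofCoord, map_zero, add_zero]
  rfl

/-- The differential of f_* acts as df ⊕ df on (π_*A, KA). For the converse, vertical vectors along
the zero section isolate the second summand of the metric. -/
theorem CommutesWithConnectors.isometric_iff (hf : ContMDiff (𝓡 n) (𝓡 d) ∞ f)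
    (hc : CommutesWithConnectors S.conn S'.conn f) :
    (∀ (p : M) (v w : TangentSpace (𝓡 n) p),
      S'.metric.inner (f p) (mfderiv (𝓡 n) (𝓡 d) f p v) (mfderiv (𝓡 n) (𝓡 d) f p w)
        = S.metric.inner p v w) ↔
    ∀ u A B, tangentMetric S' (tangentMap (𝓡 n) (𝓡 d) f u)
      (mfderiv (𝓡 n).tangent (𝓡 d).tangent (tangentMap (𝓡 n) (𝓡 d) f) u A)
      (mfderiv (𝓡 n).tangent (𝓡 d).tangent (tangentMap (𝓡 n) (𝓡 d) f) u B)
        = tangentMetric S u A B := by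
  have key : ∀ u A B, tangentMetric S' (tangentMap (𝓡 n) (𝓡 d) f u)
      (mfderiv (𝓡 n).tangent (𝓡 d).tangent (tangentMap (𝓡 n) (𝓡 d) f) u A)
      (mfderiv (𝓡 n).tangent (𝓡 d).tangent (tangentMap (𝓡 n) (𝓡 d) f) u B)
      = S'.metric.inner (f u.proj) (mfderiv (𝓡 n) (𝓡 d) f u.proj (projDeriv u A))
          (mfderiv (𝓡 n) (𝓡 d) f u.proj (projDeriv u B))
        + S'.metric.inner (f u.proj) (mfderiv (𝓡 n) (𝓡 d) f u.proj (connector S.conn u A))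
          (mfderiv (𝓡 n) (𝓡 d) f u.proj (connector S.conn u B)) := fun u A B =>
    congrArg₂ (· + ·)
      (congrArg₂ (fun v w => S'.metric.inner (f u.proj) v w)
        (projDeriv_mfderiv_tangentMap hf u A) (projDeriv_mfderiv_tangentMap hf u B))
      (congrArg₂ (fun v w => S'.metric.inner (f u.proj) v w) (hc u A) (hc u B))
  constructor
  · intro h u A B
    rw [key, h, h]
    rfl
  · intro h p v w
    let u : TangentBundle (𝓡 n) M := ⟨p, 0⟩
    have h1 := (key u (ofCoord u 0 v) (ofCoord u 0 w)).symm.trans (h u _ _)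
    rw [tangentMetric, connector_ofCoord_zero, connector_ofCoord_zero, projDeriv_ofCoord,
      projDeriv_ofCoord] at h1
    simpa using h1

end Lift

/-! ### Integrality of the matrix, equivariance, and both directions of the equivalence -/

section Equivariance

variable {n d : ℕ}
  {M : Type*} [TopologicalSpace M] [ChartedSpace (RModel n) M] [IsManifold (𝓡 n) ∞ M]
  {M' : Type*} [TopologicalSpace M'] [ChartedSpace (RModel d) M'] [IsManifold (𝓡 d) ∞ M']
  {N : Type*} [TopologicalSpace N] [ChartedSpace (CModel n) N] [IsManifold 𝓘(ℂ, CModel n) ω N]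
  {N' : Type*} [TopologicalSpace N'] [ChartedSpace (CModel d) N']
  [IsManifold 𝓘(ℂ, CModel d) ω N']
  {S : DuallyFlat n M} {S' : DuallyFlat d M'} {G : Kahler n N} {G' : Kahler d N'}
  {Φ : TorusAction G} {Φ' : TorusAction G'} {f : M → M'} {m : N → N'}
  {cov : Conn n M} {L : Set (TangentBundle (𝓡 n) M)} {X : Fin n → Π p : M, TangentSpace (𝓡 n) p}
  {cov' : Conn d M'} {L' : Set (TangentBundle (𝓡 d) M')}
  {X' : Fin d → Π p : M', TangentSpace (𝓡 d) p} {a : RModel n →L[ℝ] RModel d}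

theorem HasFrameMatrix.mfderiv_frameMap (ha : HasFrameMatrix X X' f a) (hX : IsGenerator cov L X)
    (hX' : IsGenerator cov' L' X') (p : M) (c : RModel n) :
    mfderiv (𝓡 n) (𝓡 d) f p (frameMap X p c) = frameMap X' (f p) (a c) := by
  have h : coframe X' (f p) (mfderiv (𝓡 n) (𝓡 d) f p (frameMap X p c))
      = a (coframe X p (frameMap X p c)) := ha ⟨p, frameMap X p c⟩
  rw [hX.coframe_frameMap] at h
  rw [← h, hX'.frameMap_coframe]

theorem HasFrameMatrix.tangentMap_translate (ha : HasFrameMatrix X X' f a)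
    (hX : IsGenerator cov L X) (hX' : IsGenerator cov' L' X') (t : Fin n → ℝ)
    (u : TangentBundle (𝓡 n) M) :
    tangentMap (𝓡 n) (𝓡 d) f (translate X t u)
      = translate X' (fun j => a (WithLp.toLp 2 t) j) (tangentMap (𝓡 n) (𝓡 d) f u) := by
  refine congrArg (Bundle.TotalSpace.mk (f u.proj)) ?_
  have h := ha.mfderiv_frameMap hX hX' u.proj (WithLp.toLp 2 t)
  rw [frameMap_apply, frameMap_apply] at h
  exact (map_add (mfderiv (𝓡 n) (𝓡 d) f u.proj) u.2 _).trans
    (congrArg (fun z => mfderiv (𝓡 n) (𝓡 d) f u.proj u.2 + z) h)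

theorem HasFrameMatrix.injective (ha : HasFrameMatrix X X' f a)
    (hX : IsGenerator cov L X) (hX' : IsGenerator cov' L' X') {p : M}
    (hf : Function.Injective (mfderiv (𝓡 n) (𝓡 d) f p)) : Function.Injective a := by
  intro c c' h
  have h1 : mfderiv (𝓡 n) (𝓡 d) f p (frameMap X p c)
      = mfderiv (𝓡 n) (𝓡 d) f p (frameMap X p c') := by
    rw [ha.mfderiv_frameMap hX hX', ha.mfderiv_frameMap hX hX', h]
  have h2 := congrArg (coframe X p) (hf h1)
  rwa [hX.coframe_frameMap, hX.coframe_frameMap] at h2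

/-- Equivariance before integrality is known: it is stated for vectors t, since a need not yet
descend to the tori. -/
theorem lift_cover_translate (P : ToricParametrization S Φ) (P' : ToricParametrization S' Φ')
    (hcomp : ∀ u, m (P.cover u) = P'.cover (tangentMap (𝓡 n) (𝓡 d) f u))
    (ha : HasFrameMatrix P.X P'.X f a) (t : Fin n → ℝ) (u : TangentBundle (𝓡 n) M) :
    m (Φ.act (Torus.mk t) (P.cover u))
      = Φ'.act (Torus.mk fun j => a (WithLp.toLp 2 t) j) (m (P.cover u)) := by
  have h1 : P.cover (translate P.X t u) = Φ.act (Torus.mk t) (P.cover u) := P.equivariant t u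
  rw [← h1, hcomp, hcomp, ha.tangentMap_translate P.isGenerator P'.isGenerator]
  exact P'.equivariant _ _

theorem torusMk_single (i : Fin n) : Torus.mk (Pi.single i (1 : ℝ)) = 0 := by
  funext j
  change ((Pi.single i (1 : ℝ) : Fin n → ℝ) j : UnitAddCircle) = 0
  by_cases h : j = i
  · subst h
    rw [Pi.single_eq_same]
    exact AddCircle.coe_period 1
  · rw [Pi.single_eq_of_ne h]
    rfl

/-- The matrix of a liftable map in the parallel frames is integral. -/
theorem exists_integral_matrix [Nonempty M] (P : ToricParametrization S Φ)
    (P' : ToricParametrization S' Φ')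
    (hcomp : ∀ u, m (P.cover u) = P'.cover (tangentMap (𝓡 n) (𝓡 d) f u))
    (ha : HasFrameMatrix P.X P'.X f a) :
    ∃ A : Matrix (Fin d) (Fin n) ℤ, ∀ (t : Fin n → ℝ) (j : Fin d),
      a (WithLp.toLp 2 t) j = ∑ i, (A j i : ℝ) * t i := by
  obtain ⟨p₀⟩ := ‹Nonempty M›
  -- The i-th basis vector acts trivially on N, so its image under a fixes a point of N' lying in
  -- the free set, and must be zero in the torus.
  have hentry : ∀ j i, ∃ k : ℤ, (k : ℝ) = a (WithLp.toLp 2 (Pi.single i (1 : ℝ))) j := by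
    intro j i
    have h1 := lift_cover_translate P P' hcomp ha (Pi.single i (1 : ℝ)) ⟨p₀, 0⟩
    rw [torusMk_single, Φ.act_zero] at h1
    have h2 : m (P.cover ⟨p₀, 0⟩) ∈ Φ'.free := by
      rw [hcomp]
      exact P'.cover_mem_free _
    have h3 := congrFun (h2 _ h1.symm) j
    obtain ⟨k, hk⟩ := AddCircle.coe_eq_zero_iff (1 : ℝ) |>.1 h3
    exact ⟨k, by simpa using hk⟩
  choose A hA using hentry
  refine ⟨A, fun t j => ?_⟩
  have ht : WithLp.toLp 2 t = ∑ i, t i • (WithLp.toLp 2 (Pi.single i (1 : ℝ)) : RModel n) := by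
    ext k
    simp [Pi.single_apply]
  rw [ht, map_sum]
  simp only [map_smul]
  rw [WithLp.ofLp_sum, Finset.sum_apply]
  refine Finset.sum_congr rfl fun i _ => ?_
  rw [hA j i, WithLp.ofLp_smul, Pi.smul_apply, smul_eq_mul, mul_comm]

theorem act_injective_of_mem_free {p : N} (hp : p ∈ Φ.free) {b c : Torus n}
    (h : Φ.act b p = Φ.act c p) : b = c := by
  have h1 : Φ.act (-c + b) p = p := by
    rw [Φ.act_add, h, ← Φ.act_add, neg_add_cancel, Φ.act_zero]
  exact (neg_add_eq_zero.1 (hp _ h1)).symm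

theorem injective_of_isIsometric (hm : IsIsometric G G' m) (p : N) :
    Function.Injective (mfderiv 𝓘(ℝ, CModel n) 𝓘(ℝ, CModel d) m p) := by
  refine (injective_iff_map_eq_zero _).2 fun v hv => ?_
  by_contra hne
  have h := G.metric.pos p v hne
  rw [← hm p v v, hv] at h
  simp at h

theorem injective_of_isometric
    (hf : ∀ (p : M) (v w : TangentSpace (𝓡 n) p),
      S'.metric.inner (f p) (mfderiv (𝓡 n) (𝓡 d) f p v) (mfderiv (𝓡 n) (𝓡 d) f p w)
        = S.metric.inner p v w) (p : M) :
    Function.Injective (mfderiv (𝓡 n) (𝓡 d) f p) := by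
  refine (injective_iff_map_eq_zero _).2 fun v hv => ?_
  by_contra hne
  have h := S.metric.pos p v hne
  rw [← hf p v v, hv] at h
  simp at h

/-- A lift of an isometric affine immersion is a Kähler immersion. -/
theorem isKahlerImmersion_of_base [ConnectedSpace M] [T2Space N] [PreconnectedSpace N]
    (P : ToricParametrization S Φ) (P' : ToricParametrization S' Φ')
    (hm : ContMDiff 𝓘(ℝ, CModel n) 𝓘(ℝ, CModel d) ∞ m)
    (hcomp : ∀ u, m (P.cover u) = P'.cover (tangentMap (𝓡 n) (𝓡 d) f u))
    (hf : IsIsometricAffineImmersion S S' f) : IsKahlerImmersion G G' m := by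
  have hcomp' : m ∘ P.cover = P'.cover ∘ tangentMap (𝓡 n) (𝓡 d) f := funext hcomp
  have hT := (hf.smooth.contMDiff_tangentMap (m := ∞) (by simp)).mdifferentiable (by simp)
  obtain ⟨a, ha⟩ := exists_hasFrameMatrix P.isGenerator
    (hf.affine.pushCoord_eventually_eq P.isGenerator P'.isGenerator hf.smooth)
  have hc := ha.commutesWithConnectors P.isGenerator P'.isGenerator hf.smooth
  have hiso : IsIsometric G G' m := by
    refine isIsometric_of_dense G G' hm Φ.dense_free fun p hp => ?_
    obtain ⟨u, rfl⟩ := P.exists_cover_eq hp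
    refine (P.isometric_comp_cover_iff hm u).1 ?_
    rw [hcomp']
    intro A B
    exact (P'.inner_cover_comp (hT u) A B).trans
      ((hc.isometric_iff hf.smooth).1 hf.isometric u A B)
  refine ⟨hm, injective_of_isIsometric hiso, ?_, hiso⟩
  refine isHolomorphic_of_dense hm Φ.dense_free fun p hp => ?_
  obtain ⟨u, rfl⟩ := P.exists_cover_eq hp
  refine (P.commutes_comp_cover_iff hm u).1 ?_
  rw [hcomp']
  exact (P'.commutes_cover_comp_iff (hT u)).2 ((commutesWithConnectors_iff hf.smooth).1 hc u)

/-- A map with a Kähler immersion as lift is an isometric affine immersion. -/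
theorem isIsometricAffineImmersion_of_lift [ConnectedSpace M]
    (P : ToricParametrization S Φ) (P' : ToricParametrization S' Φ')
    (hf : ContMDiff (𝓡 n) (𝓡 d) ∞ f)
    (hcomp : ∀ u, m (P.cover u) = P'.cover (tangentMap (𝓡 n) (𝓡 d) f u))
    (hm : IsKahlerImmersion G G' m) : IsIsometricAffineImmersion S S' f := by
  have hcomp' : m ∘ P.cover = P'.cover ∘ tangentMap (𝓡 n) (𝓡 d) f := funext hcomp
  have hT := (hf.contMDiff_tangentMap (m := ∞) (by simp)).mdifferentiable (by simp)
  have hc : CommutesWithConnectors S.conn S'.conn f := by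
    refine (commutesWithConnectors_iff hf).2 fun u => ?_
    refine (P'.commutes_cover_comp_iff (hT u)).1 ?_
    rw [← hcomp']
    exact (P.commutes_comp_cover_iff hm.smooth u).2 (hm.holomorphic _)
  have hiso := (hc.isometric_iff hf).2 fun u A B => by
    refine (P'.inner_cover_comp (hT u) A B).symm.trans ?_
    rw [← hcomp']
    exact (P.isometric_comp_cover_iff hm.smooth u).2 (hm.isometric _) A B
  obtain ⟨a, ha⟩ := exists_hasFrameMatrix P.isGenerator
    (hc.pushCoord_eventually_eq P.isGenerator P'.isGenerator hf)
  exact ⟨hf, injective_of_isometric hiso, hiso, ha.isAffineMap P.isGenerator P'.isGenerator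
    S.flat.torsion_eq_zero S'.flat.torsion_eq_zero hf⟩

/-- A lift of an isometric affine immersion is equivariant along a unique homomorphism of tori. -/
theorem exists_equivariance_hom [ConnectedSpace M] [T2Space N] [PreconnectedSpace N] [T2Space N']
    (P : ToricParametrization S Φ) (P' : ToricParametrization S' Φ')
    (hm : ContMDiff 𝓘(ℝ, CModel n) 𝓘(ℝ, CModel d) ∞ m)
    (hcomp : ∀ u, m (P.cover u) = P'.cover (tangentMap (𝓡 n) (𝓡 d) f u))
    (hf : IsIsometricAffineImmersion S S' f) :
    ∃ ρ : Torus n →+ Torus d, IsLieHom ρ ∧ (ρ.ker : Set (Torus n)).Finite ∧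
      (∀ b p, m (Φ.act b p) = Φ'.act (ρ b) (m p)) ∧
      ∀ ρ' : Torus n →+ Torus d,
        (∀ b p, m (Φ.act b p) = Φ'.act (ρ' b) (m p)) → ρ' = ρ := by
  obtain ⟨a, ha⟩ := exists_hasFrameMatrix P.isGenerator
    (hf.affine.pushCoord_eventually_eq P.isGenerator P'.isGenerator hf.smooth)
  obtain ⟨A, hA⟩ := exists_integral_matrix P P' hcomp ha
  obtain ⟨p₀⟩ := (inferInstance : Nonempty M)
  have hequiv : ∀ b p, m (Φ.act b p) = Φ'.act (torusHom A b) (m p) := by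
    intro b
    -- Both sides are continuous in p with values in a Hausdorff space, so it is enough to compare
    -- them on the free points, which the covering map reaches.
    refine fun p => congrFun (Continuous.ext_on Φ.dense_free
      (hm.continuous.comp (Φ.contMDiff_act b).continuous)
      ((Φ'.contMDiff_act (torusHom A b)).continuous.comp hm.continuous) ?_) p
    intro p hp
    obtain ⟨u, rfl⟩ := P.exists_cover_eq hp
    obtain ⟨t, rfl⟩ := torusMk_surjective n b
    have h := lift_cover_translate P P' hcomp ha t u
    simp only [hA] at h
    rw [← torusHom_mk] at h
    exact h
  refine ⟨torusHom A, isLieHom_torusHom A, finite_ker_torusHom A ?_, hequiv, ?_⟩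
  · intro t t' h
    have h1 : a (WithLp.toLp 2 t) = a (WithLp.toLp 2 t') := by
      ext j
      rw [hA, hA]
      exact congrFun h j
    have h2 := ha.injective P.isGenerator P'.isGenerator (hf.immersion p₀) h1
    exact congrArg WithLp.ofLp h2
  · intro ρ' h
    refine AddMonoidHom.ext fun b => ?_
    -- The lift sends covered points to free points, and at one free point the action already
    -- determines the torus element.
    refine act_injective_of_mem_free (p := m (P.cover ⟨p₀, 0⟩)) (Φ := Φ') ?_
      ((h b _).symm.trans (hequiv b _))
    rw [hcomp]
    exact P'.cover_mem_free _

end Equivariance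

end

end Torif

open Torif in
theorem proposition9p3 {n d : ℕ}
    {M : Type*} [TopologicalSpace M] [T2Space M] [SecondCountableTopology M] [ConnectedSpace M]
    [ChartedSpace (RModel n) M] [IsManifold (𝓡 n) ∞ M]
    {M' : Type*} [TopologicalSpace M'] [T2Space M'] [SecondCountableTopology M']
    [ConnectedSpace M'] [ChartedSpace (RModel d) M'] [IsManifold (𝓡 d) ∞ M']
    {N : Type*} [TopologicalSpace N] [T2Space N] [SecondCountableTopology N] [ConnectedSpace N]
    [ChartedSpace (CModel n) N] [IsManifold 𝓘(ℂ, CModel n) ω N]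
    {N' : Type*} [TopologicalSpace N'] [T2Space N'] [SecondCountableTopology N']
    [ConnectedSpace N'] [ChartedSpace (CModel d) N'] [IsManifold 𝓘(ℂ, CModel d) ω N']
    (S : DuallyFlat n M) (S' : DuallyFlat d M') (G : Kahler n N) (G' : Kahler d N')
    (Φ : TorusAction G) (Φ' : TorusAction G')
    (hΦ : IsTorification S Φ) (hΦ' : IsTorification S' Φ')
    (f : M → M') (m : N → N') (hlift : IsLift S Φ S' Φ' f m) :
    (IsKahlerImmersion G G' m ↔ IsIsometricAffineImmersion S S' f) ∧
    (IsIsometricAffineImmersion S S' f →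
      ∃ ρ : Torus n →+ Torus d, IsLieHom ρ ∧ (ρ.ker : Set (Torus n)).Finite ∧
        (∀ a p, m (Φ.act a p) = Φ'.act (ρ a) (m p)) ∧
        ∀ ρ' : Torus n →+ Torus d, IsLieHom ρ' →
          (∀ a p, m (Φ.act a p) = Φ'.act (ρ' a) (m p)) → ρ' = ρ) := by
  obtain ⟨τ, τ', ⟨P, hP⟩, ⟨P', hP'⟩, hτ⟩ := hlift.exists_covering
  have hcomp : ∀ u, m (P.cover u) = P'.cover (tangentMap (𝓡 n) (𝓡 d) f u) := by
    intro u
    have h := hτ u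
    rw [hP, hP'] at h
    exact h
  refine ⟨⟨isIsometricAffineImmersion_of_lift P P' hlift.smooth_base hcomp,
    isKahlerImmersion_of_base P P' hlift.smooth hcomp⟩, fun hf => ?_⟩
  obtain ⟨ρ, hρ, hker, hequiv, huniq⟩ := exists_equivariance_hom P P' hlift.smooth hcomp hf
  exact ⟨ρ, hρ, hker, hequiv, fun ρ' _ h => huniq ρ' h⟩
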